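/- **Setting.** Let $\mathcal D\subset\mathbb R^d$ be convex and compact with nonempty interior, $\nu$ a finite measure on $\mathcal D$ with a strictly positive Lebesgue density, $\mathcal H=L^2(\mathcal D,\nu)$ with norm $\|\cdot\|$ and an orthonormal basis $(e_k)_{k\in\mathbb N}$. For $r\ge0$ let $\mathcal U(r)$ be the set of functions $x$ on $\mathcal D$ with $\|x\|_\infty+\mathrm{Lip}(x)\le r$, and let $\mathcal S\subseteq\bigcup_r\mathcal U(r)$ be a linear subspace. Let $(X_t)_{t\in\mathbb Z}$ be a stationary $\mathcal S$-valued process with $X_t=\Psi(X_{t-1})+\epsilon_t$, where the $\epsilon_t$ are i.i.d., $\mathcal S$-valued, centred, and $\epsilon_t$ is independent of $(X_s)_{s<t}$. Write $p(y,u)=P(\|\epsilon_t-y\|\le u)$. Assume: 1. $K$ is supported on $[0,1]$, is $C^1$ on $[0,1]$ with $K'\le0$, and $K(1)>0$. 2. $\Psi$ is Lipschitz on $\mathcal S$ with constant $L_\Psi<1$, and $\sup_{x\in\mathcal S}\mathrm{Lip}(\Psi(x))<\infty$. 3. For some $x_0\in\mathcal S$, $z_0\in\mathcal H$, $\alpha>0$,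 and all $u>0$ in a neighbourhood of $0$: $p(x_0,u)>0$; $p(y,u)\le p(z_0,u)$ for all $y\in\mathcal H$; $y\mapsto p(y,u)/p(x_0,u)$ is $\alpha$-Hölder on $\mathcal S$ with a constant independent of $u$; and $p(y,u+\eta)-p(y,u-\eta)\le \tilde L\,\eta u^{-1}p(y,u)$ for $0<\eta\le u$, $y\in\mathcal S$, with $\tilde L$ independent of $u,\eta,y$. 4. $p(y,u)=f_\epsilon(y)\phi(u)+g_\epsilon(u,y)$ with $f_\epsilon\ge0$ on $\mathcal S$, $\phi>0$ near $0$ and $\sup_{y\in\mathcal U(r)\cap\mathcal S}|g_\epsilon(u,y)|=o(\phi(u))$ as $u\downarrow0$ for every $r$; and $\sup_{s\in[0,1]}|\phi(us)/\phi(u)-\tau_0(s)|\to0$ as $u\downarrow0$ for some $\tau_0:[0,1]\to[0,1]$ that is continuous near $0$ with $\tau_0(0)=0$. Put $f_X(x)=\mathbb E f_\epsilon(x-\Psi(X_0))$. 5. $\sum_{k>m}\mathbb E\langle X_t,e_k\rangle^2\vee\sum_{k>m}\mathbb E\langle\epsilon_t,e_k\rangle^2\le a_0e^{-a_1m}$ for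 all $m$ with some $a_0,a_1>0$; for some $C\in\mathbb R$ and $\tilde H>1$, $\mathbb E\|\epsilon_t\|^m\le C\,m!\,\tilde H^{m-2}$ for all $m\ge2$; and $\mathrm{Lip}(\epsilon_t)$ is a.s. bounded by a constant. 6. $h=h_n>0$, $h_n\to0$, and for every $r$, almost surely as $n\to\infty$, $$\sup_{x\in\mathcal U(r)\cap\mathcal S}\Big\{\Big|\tfrac1n\sum_{t=1}^nf_\epsilon(x-\Psi(X_{t-1}))-f_X(x)\Big|+\tfrac1n\sum_{t=1}^n\frac{|g_\epsilon(h,x-\Psi(X_{t-1}))|}{\phi(h)}\Big\}\to0 .$$ Let $\tilde\Psi_{n,h}(x)=\sum_{t=1}^nX_{t+1}K(\|X_t-x\|/h)\big/\sum_{t=1}^nK(\|X_t-x\|/h)$ (read as $0$ if the denominator vanishes). For real $r_n\to\infty$ let $\hat\Psi_{n,h}(x)=\tilde\Psi_{n,h}(x)$ for $x\in\mathcal S\cap\mathcal U(r_n)$ and $\hat\Psi_{n,h}(x)=n^{-1}\sum_{t=1}^nX_t$ for $x\in\mathcal S\setminus\mathcal U(r_n)$. Write $B_n=\mathcal O_{a.c.}(\lambda_n)$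 if $\sum_nP(|B_n|>C\lambda_n)<\infty$ for some $C>0$. Let $N(U,\eta)$ be the least number of closed $\eta$-balls of $\mathcal H$ covering $U$. **Theorem.** Let $U\subseteq\mathcal S$ be totally bounded in $\mathcal H$ with $\inf_{x\in U}f_X(x)>0$, let $\lambda_n>0$, $\lambda_n\to0$, $\varepsilon_n=h\lambda_n$, and assume that for some $c>0$ $$\sum_n\exp\Big[-c\,\lambda_n^2\,\frac{n\phi(h)}{\log n}\Big]\log n<\infty,\qquad \frac{\log N(U,\varepsilon_n)\,\log n}{n\phi(h)\lambda_n^2}\to0 .$$ Then there are real numbers $a_n=\mathcal O(h)$ and real random variables $B_n=\mathcal O_{a.c.}(\lambda_n)$ such that, for all $n$, $$\sup_{x\in U}\|\tilde\Psi_{n,h}(x)-\Psi(x)\|\le a_n+B_n ,$$ and, if $U\subseteq\mathcal U(\rho)$ for some $\rho$, also $$\sup_{x\in U}\|\hat\Psi_{n,h}(x)-\Psi(x)\|\le a_n+B_n .$$ In particular, if $\limsup_n h/\lambda_n<\infty$, the first supremum is $\mathcal O_{a.c.}(\lambda_n)$, and so is the second if $U\subseteq\mathcal U(\rho)$ for some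 $\rho$. -/

import Mathlib

open MeasureTheory ProbabilityTheory Filter Topology Asymptotics
open scoped ENNReal NNReal

noncomputable section

/-- `ℝᵈ` with the Euclidean norm. -/
abbrev Euc (d : ℕ) : Type := EuclideanSpace ℝ (Fin d)

/-- The Hilbert space `ℋ = L²(𝒟, ℬ(𝒟), ν)`; the measure `ν` is carried by `𝒟`, see `IsRegularDomain`. -/
abbrev L2Fun {d : ℕ} (ν : Measure (Euc d)) : Type := Lp ℝ 2 ν

instance instMeasurableSpaceL2Fun {d : ℕ} (ν : Measure (Euc d)) :
    MeasurableSpace (L2Fun ν) := borel _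

instance instBorelSpaceL2Fun {d : ℕ} (ν : Measure (Euc d)) : BorelSpace (L2Fun ν) := ⟨rfl⟩

/-- `𝒟` is a convex compact set with nonempty interior, and `ν` is a finite measure on `𝒟` with a
strictly positive Lebesgue density. -/
structure IsRegularDomain {d : ℕ} (D : Set (Euc d)) (ν : Measure (Euc d)) : Prop where
  convex : Convex ℝ D
  isCompact : IsCompact D
  nonempty_interior : (interior D).Nonempty
  finite : IsFiniteMeasure ν
  density : ∃ ρ : Euc d → ℝ≥0∞, Measurable ρ ∧ (∀ u ∈ D, 0 < ρ u) ∧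
    ν = (volume.restrict D).withDensity ρ

section FunctionClasses

variable {d : ℕ} (D : Set (Euc d)) (ν : Measure (Euc d))

/-- `x ∈ ℋ` has a representative on `𝒟` whose Lipschitz constant is at most `C`. -/
def LipConstLE (C : ℝ) (x : L2Fun ν) : Prop :=
  ∃ f : Euc d → ℝ, x =ᵐ[ν] f ∧ ∀ u ∈ D, ∀ v ∈ D, |f u - f v| ≤ C * ‖u - v‖

/-- `𝒰(r)`: the (classes of) functions on `𝒟` for which the sum of the sup-norm and of the smallest
Lipschitz constant is at most `r`. -/
def lipBall (r : ℝ) : Set (L2Fun ν) :=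
  {x | ∃ f : Euc d → ℝ, x =ᵐ[ν] f ∧ ∃ M L : ℝ, 0 ≤ L ∧ M + L ≤ r ∧
    (∀ u ∈ D, |f u| ≤ M) ∧ ∀ u ∈ D, ∀ v ∈ D, |f u - f v| ≤ L * ‖u - v‖}

end FunctionClasses

/-- The kernel: support `[0,1]`, continuously differentiable on `[0,1]` with `K' ≤ 0`,
and `K(1) > 0`. -/
structure IsKernel (K : ℝ → ℝ) : Prop where
  support : ∀ s, s ∉ Set.Icc (0 : ℝ) 1 → K s = 0
  contDiffOn : ContDiffOn ℝ 1 K (Set.Icc 0 1)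
  deriv_nonpos : ∀ s ∈ Set.Icc (0 : ℝ) 1, derivWithin K (Set.Icc 0 1) s ≤ 0
  pos : 0 < K 1

section Model

variable {d : ℕ} {D : Set (Euc d)} {ν : Measure (Euc d)} {Ω : Type*} [MeasurableSpace Ω]

/-- The regression operator: a contraction on `𝒮` whose values on `𝒮` are functions with uniformly
bounded Lipschitz constants. -/
structure IsRegressionOperator (D : Set (Euc d)) (S : Submodule ℝ (L2Fun ν))
    (Ψ : L2Fun ν → L2Fun ν) : Prop where
  contraction : ∃ L : ℝ≥0, L < 1 ∧ LipschitzOnWith L Ψ (S : Set (L2Fun ν))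
  lip : ∃ C : ℝ, ∀ x ∈ S, LipConstLE D ν C (Ψ x)

/-- `(X t)` is a (strictly) stationary, causal functional autoregression of order one with i.i.d.
centred innovations `ε t`; observations and innovations take values in `𝒮`. -/
structure IsFAR1 (μ : Measure Ω) (S : Submodule ℝ (L2Fun ν)) (Ψ : L2Fun ν → L2Fun ν)
    (X ε : ℤ → Ω → L2Fun ν) : Prop where
  measurable_X : ∀ t, Measurable (X t)
  measurable_ε : ∀ t, Measurable (ε t)
  mem_X : ∀ t ω, X t ω ∈ S
  mem_ε : ∀ t ω, ε t ω ∈ S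
  equation : ∀ t, ∀ᵐ ω ∂μ, X t ω = Ψ (X (t - 1) ω) + ε t ω
  indep : iIndepFun ε μ
  identDistrib : ∀ t, IdentDistrib (ε t) (ε 0) μ μ
  integrable : Integrable (ε 0) μ
  centred : ∫ ω, ε 0 ω ∂μ = 0
  stationary : ∀ k : ℤ, IdentDistrib (fun ω t => X (t + k) ω) (fun ω t => X t ω) μ μ
  causal : ∀ t : ℤ, IndepFun (fun ω (s : Set.Iio t) => X s ω) (ε t) μ

/-- Moment conditions: exponentially decaying tails of the coordinates w.r.t. the orthonormal basis
`e`, Bernstein moments of the innovations, uniformly bounded Lipschitz constants of the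
innovations. -/
structure MomentCond (D : Set (Euc d)) (μ : Measure Ω) (e : HilbertBasis ℕ ℝ (L2Fun ν))
    (X ε : ℤ → Ω → L2Fun ν) : Prop where
  tails : ∃ a₀ a₁ : ℝ, 0 < a₀ ∧ 0 < a₁ ∧ ∀ (t : ℤ) (m : ℕ),
    ∑' k : ℕ, ∫⁻ ω, ‖inner ℝ (e (m + 1 + k)) (X t ω)‖ₑ ^ 2 ∂μ
        ≤ ENNReal.ofReal (a₀ * Real.exp (-a₁ * m)) ∧
    ∑' k : ℕ, ∫⁻ ω, ‖inner ℝ (e (m + 1 + k)) (ε t ω)‖ₑ ^ 2 ∂μ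
        ≤ ENNReal.ofReal (a₀ * Real.exp (-a₁ * m))
  bernstein : ∃ C H : ℝ, 1 < H ∧ ∀ m : ℕ, 2 ≤ m →
    Integrable (fun ω => ‖ε 0 ω‖ ^ m) μ ∧ ∫ ω, ‖ε 0 ω‖ ^ m ∂μ ≤ C * (m.factorial : ℝ) * H ^ (m - 2)
  lip : ∃ C : ℝ, ∀ᵐ ω ∂μ, LipConstLE D ν C (ε 0 ω)

/-- The small ball probability `P(‖Z - y‖ ≤ u)`. -/
def smallBall (μ : Measure Ω) (Z : Ω → L2Fun ν) (y : L2Fun ν) (u : ℝ) : ℝ :=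
  μ.real {ω | ‖Z ω - y‖ ≤ u}

/-- The remainder `g_ε(u, y)` in `P(‖Z - y‖ ≤ u) = f_ε(y) φ(u) + g_ε(u, y)`. -/
def smallBallRem (μ : Measure Ω) (Z : Ω → L2Fun ν) (f : L2Fun ν → ℝ) (φ : ℝ → ℝ)
    (u : ℝ) (y : L2Fun ν) : ℝ :=
  smallBall μ Z y u - f y * φ u

/-- Regularity of the small ball probabilities of the innovation `Z`, with Hölder exponent `α`,
reference point `x₀`, density functional `f` and small ball rate `φ`. -/
structure SmallBallCond (D : Set (Euc d)) (μ : Measure Ω) (S : Submodule ℝ (L2Fun ν))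
    (Z : Ω → L2Fun ν) (α : ℝ) (x₀ : L2Fun ν) (f : L2Fun ν → ℝ) (φ : ℝ → ℝ) : Prop where
  pos : ∀ᶠ u in 𝓝[>] (0 : ℝ), 0 < smallBall μ Z x₀ u
  maximal : ∃ z₀ : L2Fun ν, ∀ᶠ u in 𝓝[>] (0 : ℝ), ∀ y,
    smallBall μ Z y u ≤ smallBall μ Z z₀ u
  holder : ∃ C : ℝ, ∀ᶠ u in 𝓝[>] (0 : ℝ), ∀ y₁ ∈ S, ∀ y₂ ∈ S,
    |smallBall μ Z y₁ u / smallBall μ Z x₀ u - smallBall μ Z y₂ u / smallBall μ Z x₀ u|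
      ≤ C * ‖y₁ - y₂‖ ^ α
  annulus : ∃ L : ℝ, ∀ᶠ u in 𝓝[>] (0 : ℝ), ∀ η, 0 < η → η ≤ u → ∀ y ∈ S,
    smallBall μ Z y (u + η) - smallBall μ Z y (u - η) ≤ L * (η / u) * smallBall μ Z y u
  f_nonneg : ∀ y ∈ S, 0 ≤ f y
  φ_pos : ∀ᶠ u in 𝓝[>] (0 : ℝ), 0 < φ u
  expansion : ∀ r : ℝ, ∀ δ > 0, ∀ᶠ u in 𝓝[>] (0 : ℝ), ∀ y ∈ lipBall D ν r ∩ S,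
    |smallBallRem μ Z f φ u y| ≤ δ * φ u
  ratio : ∃ τ : ℝ → ℝ, (∀ s ∈ Set.Icc (0 : ℝ) 1, τ s ∈ Set.Icc (0 : ℝ) 1) ∧
    (∃ δ > 0, ContinuousOn τ (Set.Icc 0 δ)) ∧ τ 0 = 0 ∧
    ∀ δ > 0, ∀ᶠ u in 𝓝[>] (0 : ℝ), ∀ s ∈ Set.Icc (0 : ℝ) 1, |φ (u * s) / φ u - τ s| ≤ δ

/-- `f_X(x) = E[f_ε(x - Ψ(X_t))]` (it does not depend on `t`, by stationarity). -/
def fX (μ : Measure Ω) (Ψ : L2Fun ν → L2Fun ν) (X : ℤ → Ω → L2Fun ν) (f : L2Fun ν → ℝ)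
    (x : L2Fun ν) : ℝ :=
  ∫ ω, f (x - Ψ (X 0 ω)) ∂μ

/-- Ergodicity of the conditional small ball probabilities along the bandwidths `h n`: almost
surely, for every `r`, uniformly in `x ∈ 𝒰(r) ∩ 𝒮`,
`|n⁻¹ ∑ₜ f_ε(x - Ψ(X_{t-1})) - f_X(x)| + n⁻¹ ∑ₜ |g_ε(h, x - Ψ(X_{t-1}))| / φ(h) → 0`. -/
def ErgodicCond (D : Set (Euc d)) (μ : Measure Ω) (S : Submodule ℝ (L2Fun ν))
    (Ψ : L2Fun ν → L2Fun ν) (X ε : ℤ → Ω → L2Fun ν) (f : L2Fun ν → ℝ) (φ : ℝ → ℝ)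
    (h : ℕ → ℝ) : Prop :=
  ∀ r : ℝ, ∀ᵐ ω ∂μ, ∀ δ > 0, ∀ᶠ n : ℕ in atTop, ∀ x ∈ lipBall D ν r ∩ S,
    |(n : ℝ)⁻¹ * ∑ t ∈ Finset.Icc 1 n, f (x - Ψ (X ((t : ℤ) - 1) ω)) - fX μ Ψ X f x|
      + (n : ℝ)⁻¹ * ∑ t ∈ Finset.Icc 1 n,
          |smallBallRem μ (ε 0) f φ (h n) (x - Ψ (X ((t : ℤ) - 1) ω))| / φ (h n) ≤ δ

/-- The weight `Δ_{h,t}(x) = K(‖X_t - x‖ / h)`. -/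
def kweight (K : ℝ → ℝ) (X : ℤ → Ω → L2Fun ν) (h : ℝ) (t : ℤ) (x : L2Fun ν) (ω : Ω) : ℝ :=
  K (h⁻¹ * ‖X t ω - x‖)

/-- The kernel estimate `(∑ₜ Δ_{h,t}(x))⁻¹ ∑ₜ Δ_{h,t}(x) X_{t+1}`, with `t = 1, …, n`
(zero if all weights vanish). -/
def kernelEstimate (K : ℝ → ℝ) (X : ℤ → Ω → L2Fun ν) (n : ℕ) (h : ℝ) (x : L2Fun ν) (ω : Ω) :
    L2Fun ν :=
  (∑ t ∈ Finset.Icc 1 n, kweight K X h t x ω)⁻¹ •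
    ∑ t ∈ Finset.Icc 1 n, kweight K X h t x ω • X ((t : ℤ) + 1) ω

open Classical in
/-- The estimator `Ψ̂_{n,h}`: the kernel estimate on `𝒰(r)`, the sample mean off `𝒰(r)`; it is
evaluated on `𝒮` only, and `r = r_n`. -/
def psiHat (D : Set (Euc d)) (K : ℝ → ℝ) (X : ℤ → Ω → L2Fun ν) (r : ℝ) (n : ℕ) (h : ℝ)
    (x : L2Fun ν) (ω : Ω) : L2Fun ν :=
  if x ∈ lipBall D ν r then kernelEstimate K X n h x ω
  else (n : ℝ)⁻¹ • ∑ t ∈ Finset.Icc 1 n, X (t : ℤ) ω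

/-- `B_n = O_{a.c.}(λ_n)` (almost complete rate): `∑ₙ P(|B_n| > C λ_n) < ∞` for some `C > 0`. -/
def IsBigOAC (μ : Measure Ω) (B : ℕ → Ω → ℝ) (lam : ℕ → ℝ) : Prop :=
  ∃ C > 0, ∑' n, μ {ω | C * lam n < |B n ω|} ≠ ⊤

end Model

/-- The covering number `N(U, η, ‖·‖)`: the least number of closed `η`-balls of `ℋ` (with arbitrary
centres in `ℋ`) that cover `U`; it is finite for totally bounded `U` and `η > 0`. -/
def coverNum {d : ℕ} {ν : Measure (Euc d)} (U : Set (L2Fun ν)) (η : ℝ) : ℕ :=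
  (Metric.externalCoveringNumber η.toNNReal U).toNat

end

/-!
On `U` the error of the kernel estimate splits into a bias, at most `h n` because `Ψ` contracts and only
observations within `h n` of `x` carry weight, and a noise term `‖∑ Δ_t ε_{t+1}‖ / ∑ Δ_t`. It has to be
shown that the noise term is at most `C * lam n` uniformly on `U`, outside events of summable
probability; on these events a crude measurable envelope serves as the random part of the bound.

Write `s = n * φ (h n)`.
* The numerator is a Hilbert space valued martingale. By `cosh_norm_add_le`, which comes from the
  convexity of `u ↦ cosh √u`, and by Bernstein's moment condition,
  `cosh (θ * ‖∑ Δ_t ε_{t+1}‖) * exp (-c * θ ^ 2 * ∑ Δ_t)` is a supermartingale for small `θ`. This gives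
  an exponential inequality in the space itself (`IsContractiveChain.measure_noise_le`), so that no
  truncation to finitely many coordinates is necessary, and the exponent is a multiple of
  `lam n ^ 2 * s`, without a logarithmic loss.
* Passing from a net of `U` of mesh `2 * h n * lam n` to all of `U` changes the weights by at most a
  multiple of `oscWeight`, whose conditional mean is of order `lam n * φ (h n)` by the annulus
  condition; the sums are controlled by Chernoff bounds.
* The denominator needs a lower bound of order `s` with *summable* exceptional probabilities, which
  almost sure ergodicity does not provide. The contraction does: almost every point of the trajectory
  has all its neighbourhoods visited linearly often, outside events of summable probability
  (`IsContractiveChain.ae_visitsLinearly_ball`). Since `f_X` is bounded below on `U` and the small ball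
  probabilities are equicontinuous, finitely many such neighbourhoods suffice for all of `U`
  (`exists_reference_points`), and each visit produces an observation near `x` with conditional
  probability of order `φ (h n)`.

Finally, the summability assumption forces `lam n ^ 2 * s / log n → ∞`, and by the entropy assumption the
logarithm of the size of the net is negligible against `lam n ^ 2 * s`; so the union bound over the net
is summable whatever the constant in the exponent (`eventually_mul_exp_le`).

The operator `Ψ` is Lipschitz on the subspace `S` only, which need not be measurable; measurability in
the martingale arguments is obtained by extending `Ψ` from `S` to a contraction of the whole space
(`LipschitzOnWith.exists_lipschitzWith_eqOn_submodule`).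
-/

/-! ### Hyperbolic cosine of a Hilbert space norm -/

/-- Convexity of `u ↦ cosh √u`, read off from its power series. -/
theorem cosh_sqrt_le_chord {u v s t : ℝ} (hu : 0 ≤ u) (hv : 0 ≤ v) (hs : 0 ≤ s) (ht : 0 ≤ t)
    (hst : s + t = 1) :
    Real.cosh (√(s * u + t * v)) ≤ s * Real.cosh √u + t * Real.cosh √v := by
  have key : ∀ w : ℝ, 0 ≤ w →
      HasSum (fun n : ℕ => w ^ n / ((2 * n).factorial : ℝ)) (Real.cosh √w) := by
    intro w hw
    have := Real.hasSum_cosh √w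
    simpa only [pow_mul, Real.sq_sqrt hw] using this
  refine hasSum_le (fun n => ?_) (key _ (by positivity))
    (((key u hu).mul_left s).add ((key v hv).mul_left t))
  have := (convexOn_pow (𝕜 := ℝ) n).2 hu hv hs ht hst
  simp only [smul_eq_mul] at this
  calc _ ≤ (s * u ^ n + t * v ^ n) / ((2 * n).factorial : ℝ) := by gcongr
    _ = _ := by ring

/-- Here `a`, `b`, `r` are the sides of a triangle and `c` is a cosine; the right-hand side interpolates
linearly in `c` between `cosh (a - b)` and `cosh (a + b)`. -/
theorem cosh_le_of_sq_eq {a b c r : ℝ} (hr : 0 ≤ r) (hc : |c| ≤ 1)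
    (h : r ^ 2 = a ^ 2 + 2 * (a * b * c) + b ^ 2) :
    Real.cosh r ≤ Real.cosh a * Real.cosh b + c * (Real.sinh a * Real.sinh b) := by
  obtain ⟨hc1, hc2⟩ := abs_le.1 hc
  have := cosh_sqrt_le_chord (sq_nonneg (a + b)) (sq_nonneg (a - b))
    (s := (1 + c) / 2) (t := (1 - c) / 2) (by linarith) (by linarith) (by ring)
  rw [Real.sqrt_sq_eq_abs, Real.sqrt_sq_eq_abs, Real.cosh_abs, Real.cosh_abs, Real.cosh_add,
    Real.cosh_sub, show (1 + c) / 2 * (a + b) ^ 2 + (1 - c) / 2 * (a - b) ^ 2 = r ^ 2 by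
      rw [h]; ring, Real.sqrt_sq hr] at this
  linarith

/-- One step of a Hilbert space valued random walk inside the hyperbolic cosine: the increment enters
through a linear term and through `e^{‖d‖} - 1 - ‖d‖` only. -/
theorem cosh_norm_add_le {E : Type*} [NormedAddCommGroup E] [InnerProductSpace ℝ E] (s d : E) :
    Real.cosh ‖s + d‖ ≤ Real.cosh ‖s‖ * (1 + (Real.exp ‖d‖ - 1 - ‖d‖))
      + Real.sinh ‖s‖ / ‖s‖ * inner ℝ s d := by
  rcases eq_or_ne s 0 with rfl | hs
  · simp only [zero_add, norm_zero, Real.cosh_zero, Real.sinh_zero, zero_div, one_mul,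
      add_zero, inner_zero_left, mul_zero]
    have h1 := Real.self_le_sinh_iff.2 (norm_nonneg d)
    have h2 := Real.cosh_add_sinh ‖d‖
    linarith
  rcases eq_or_ne d 0 with rfl | hd
  · simp
  have ha : 0 < ‖s‖ := norm_pos_iff.2 hs
  have hb : 0 < ‖d‖ := norm_pos_iff.2 hd
  set c : ℝ := inner ℝ s d / (‖s‖ * ‖d‖) with hc
  have hcabs : |c| ≤ 1 := abs_real_inner_div_norm_mul_norm_le_one s d
  have hin : (inner ℝ s d : ℝ) = ‖s‖ * ‖d‖ * c := by rw [hc]; field_simp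
  have h1 := cosh_le_of_sq_eq (a := ‖s‖) (b := ‖d‖) (norm_nonneg (s + d)) hcabs
    (by rw [norm_add_sq_real, hin])
  have h2 : Real.sinh ‖s‖ / ‖s‖ * inner ℝ s d = Real.sinh ‖s‖ * (‖d‖ * c) := by
    rw [hin]; field_simp
  rw [h2]
  have h3 := Real.cosh_add_sinh ‖d‖
  have h4 := Real.self_le_sinh_iff.2 hb.le
  have h5 : Real.sinh ‖s‖ ≤ Real.cosh ‖s‖ := (Real.sinh_lt_cosh _).le
  have h6 : 0 ≤ Real.sinh ‖s‖ := Real.sinh_nonneg_iff.2 ha.le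
  have h7 : c * (Real.sinh ‖s‖ * (Real.sinh ‖d‖ - ‖d‖)) ≤
      Real.cosh ‖s‖ * (Real.sinh ‖d‖ - ‖d‖) := by
    have h8 : 0 ≤ Real.sinh ‖s‖ * (Real.sinh ‖d‖ - ‖d‖) := mul_nonneg h6 (by linarith)
    calc _ ≤ 1 * (Real.sinh ‖s‖ * (Real.sinh ‖d‖ - ‖d‖)) :=
          mul_le_mul_of_nonneg_right (abs_le.1 hcabs).2 h8
      _ ≤ _ := by rw [one_mul]; exact mul_le_mul_of_nonneg_right h5 (by linarith)
  rw [← h3]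
  nlinarith [h1, h7]

/-! ### Exponential moments under Bernstein's condition -/

section Bernstein

variable {E : Type*} [NormedAddCommGroup E] [MeasurableSpace E] [BorelSpace E]

/-- Exponential moment bounds for a distribution, in the form produced by Bernstein's moment
condition and used for exponential supermartingales. -/
structure HasBernsteinBound (m : Measure E) (θ₀ V : ℝ) : Prop where
  pos : 0 < θ₀
  nonneg : 0 ≤ V
  integrable_exp : ∀ θ, 0 ≤ θ → θ ≤ θ₀ → Integrable (fun y => Real.exp (θ * ‖y‖)) m
  second_order : ∀ θ, 0 ≤ θ → θ ≤ θ₀ →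
    ∫ y, (Real.exp (θ * ‖y‖) - 1 - θ * ‖y‖) ∂m ≤ V * θ ^ 2
  first_order : ∀ θ, 0 ≤ θ → θ ≤ θ₀ → ∫ y, Real.exp (θ * ‖y‖) ∂m ≤ 1 + V * θ

theorem hasBernsteinBound_of_moments {m : Measure E} [IsProbabilityMeasure m] {C H : ℝ}
    (hH : 1 < H) (hint1 : Integrable (fun y : E => ‖y‖) m)
    (hmom : ∀ k : ℕ, 2 ≤ k → Integrable (fun y : E => ‖y‖ ^ k) m ∧
      ∫ y, ‖y‖ ^ k ∂m ≤ C * (k.factorial : ℝ) * H ^ (k - 2)) :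
    ∃ θ₀ V, HasBernsteinBound m θ₀ V := by
  have hH0 : 0 < H := by linarith
  have hC : 0 ≤ C := by
    have h := (hmom 2 le_rfl).2
    have h0 : 0 ≤ ∫ y : E, ‖y‖ ^ 2 ∂m := integral_nonneg fun y => by positivity
    norm_num at h
    linarith
  have main : ∀ θ, 0 ≤ θ → θ ≤ 1 / (2 * H) →
      Integrable (fun y : E => Real.exp (θ * ‖y‖) - 1 - θ * ‖y‖) m ∧
        ∫ y, (Real.exp (θ * ‖y‖) - 1 - θ * ‖y‖) ∂m ≤ 2 * C * θ ^ 2 := by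
    intro θ h0 h1
    have hθH : θ * H ≤ 1 / 2 := by
      calc θ * H ≤ 1 / (2 * H) * H := by gcongr
        _ = 1 / 2 := by field_simp
    have hs : ∀ y : E, HasSum (fun k : ℕ => (θ * ‖y‖) ^ (k + 2) / ((k + 2).factorial : ℝ))
        (Real.exp (θ * ‖y‖) - 1 - θ * ‖y‖) := by
      intro y
      have h := NormedSpace.expSeries_div_hasSum_exp (𝔸 := ℝ) (θ * ‖y‖)
      rw [← Real.exp_eq_exp_ℝ] at h
      have h2 := (hasSum_nat_add_iff' 2).2 h
      simp only [Finset.sum_range_succ, Finset.sum_range_zero] at h2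
      have e0 : Real.exp (θ * ‖y‖) - 1 - θ * ‖y‖ = Real.exp (θ * ‖y‖) -
          (0 + (θ * ‖y‖) ^ 0 / (Nat.factorial 0 : ℝ) + (θ * ‖y‖) ^ 1 / (Nat.factorial 1 : ℝ)) := by
        simp; ring
      rw [e0]
      exact h2
    -- The choice `θ * H ≤ 1 / 2` turns the factors `H ^ k` into a geometric series.
    have hterm : ∀ k : ℕ, ∫⁻ y, ENNReal.ofReal ((θ * ‖y‖) ^ (k + 2) / ((k + 2).factorial : ℝ)) ∂m
        ≤ ENNReal.ofReal (C * θ ^ 2 * (1 / 2) ^ k) := by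
      intro k
      obtain ⟨hi, hle⟩ := hmom (k + 2) (by omega)
      have e1 : ∀ y : E, (θ * ‖y‖) ^ (k + 2) / ((k + 2).factorial : ℝ)
          = θ ^ (k + 2) / ((k + 2).factorial : ℝ) * ‖y‖ ^ (k + 2) := by intro y; ring
      simp only [e1]
      rw [← ofReal_integral_eq_lintegral_ofReal (hi.const_mul _)
        (Eventually.of_forall fun y => by positivity)]
      refine ENNReal.ofReal_le_ofReal ?_
      rw [integral_const_mul]
      calc _ ≤ θ ^ (k + 2) / ((k + 2).factorial : ℝ) *
            (C * ((k + 2).factorial : ℝ) * H ^ (k + 2 - 2)) := by gcongr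
        _ = C * θ ^ 2 * (θ * H) ^ k := by
            rw [Nat.add_sub_cancel, mul_pow, pow_add]
            field_simp
        _ ≤ _ := by gcongr
    have hlin : ∫⁻ y, ENNReal.ofReal (Real.exp (θ * ‖y‖) - 1 - θ * ‖y‖) ∂m
        ≤ ENNReal.ofReal (2 * C * θ ^ 2) := by
      have e2 : ∀ y : E, ENNReal.ofReal (Real.exp (θ * ‖y‖) - 1 - θ * ‖y‖)
          = ∑' k : ℕ, ENNReal.ofReal ((θ * ‖y‖) ^ (k + 2) / ((k + 2).factorial : ℝ)) := by
        intro y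
        rw [← (hs y).tsum_eq, ENNReal.ofReal_tsum_of_nonneg (fun k => by positivity)
          (hs y).summable]
      simp only [e2]
      rw [lintegral_tsum fun k => by fun_prop]
      have hg : HasSum (fun k : ℕ => C * θ ^ 2 * (1 / 2 : ℝ) ^ k) (C * θ ^ 2 * 2) :=
        hasSum_geometric_two.mul_left _
      calc _ ≤ ∑' k : ℕ, ENNReal.ofReal (C * θ ^ 2 * (1 / 2) ^ k) := ENNReal.tsum_le_tsum hterm
        _ = ENNReal.ofReal (C * θ ^ 2 * 2) := by
            rw [← hg.tsum_eq, ENNReal.ofReal_tsum_of_nonneg (fun k => by positivity) hg.summable]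
        _ = _ := by ring_nf
    have hnn : ∀ y : E, 0 ≤ Real.exp (θ * ‖y‖) - 1 - θ * ‖y‖ := fun y => by
      linarith [Real.add_one_le_exp (θ * ‖y‖)]
    have hi : Integrable (fun y : E => Real.exp (θ * ‖y‖) - 1 - θ * ‖y‖) m := by
      refine ⟨by fun_prop, ?_⟩
      rw [hasFiniteIntegral_iff_ofReal (Eventually.of_forall hnn)]
      exact hlin.trans_lt ENNReal.ofReal_lt_top
    refine ⟨hi, ?_⟩
    rw [integral_eq_lintegral_of_nonneg_ae (Eventually.of_forall hnn) hi.1]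
    exact ENNReal.toReal_le_of_le_ofReal (by positivity) hlin
  set V₁ := ∫ y : E, ‖y‖ ∂m with hV₁
  have hV₁0 : 0 ≤ V₁ := integral_nonneg fun y => norm_nonneg y
  have hθ1 : 1 / (2 * H) ≤ 1 := by
    rw [div_le_one (by positivity)]; linarith
  have hexp : ∀ θ, 0 ≤ θ → θ ≤ 1 / (2 * H) → ∀ y : E, Real.exp (θ * ‖y‖)
      = (Real.exp (θ * ‖y‖) - 1 - θ * ‖y‖) + (1 + θ * ‖y‖) := fun θ _ _ y => by ring
  refine ⟨1 / (2 * H), 2 * C + V₁, by positivity, by positivity, ?_, ?_, ?_⟩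
  · intro θ h0 h1
    rw [funext (hexp θ h0 h1)]
    exact (main θ h0 h1).1.add ((integrable_const _).add (hint1.const_mul θ))
  · intro θ h0 h1
    refine (main θ h0 h1).2.trans ?_
    gcongr
    linarith
  · intro θ h0 h1
    have hi2 : Integrable (fun y : E => 1 + θ * ‖y‖) m :=
      (integrable_const _).add (hint1.const_mul θ)
    rw [funext (hexp θ h0 h1), integral_add (main θ h0 h1).1 hi2,
      integral_add (integrable_const _) (hint1.const_mul θ), integral_const_mul]
    have := (main θ h0 h1).2
    have h3 : θ ^ 2 ≤ θ := by nlinarith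
    have h4 : 2 * C * θ ^ 2 ≤ 2 * C * θ := by gcongr
    simp only [integral_const, probReal_univ, one_smul]
    linarith

end Bernstein

/-! ### Lipschitz extension from a linear subspace -/

/-- A Lipschitz self-map of a linear subspace of a Hilbert space extends to the whole space with the
same constant: extend to the closure by continuity and compose with the orthogonal projection. -/
theorem LipschitzOnWith.exists_lipschitzWith_eqOn_submodule {E : Type*} [NormedAddCommGroup E]
    [InnerProductSpace ℝ E] [CompleteSpace E] {S : Submodule ℝ E} {L : ℝ≥0} {Ψ : E → E}
    (h : LipschitzOnWith L Ψ S) : ∃ Ψ' : E → E, LipschitzWith L Ψ' ∧ ∀ x ∈ S, Ψ' x = Ψ x := by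
  set T := S.topologicalClosure
  have hT : IsClosed (T : Set E) := S.isClosed_topologicalClosure
  have : CompleteSpace T := hT.completeSpace_coe
  set s : Set T := {x | (x : E) ∈ S} with hs
  have hdense : Dense s := by
    intro x
    rw [mem_closure_iff_seq_limit]
    obtain ⟨u, hu, hux⟩ := mem_closure_iff_seq_limit.1 (show (x : E) ∈ closure (S : Set E) from x.2)
    exact ⟨fun n => ⟨u n, S.le_topologicalClosure (hu n)⟩, hu, tendsto_subtype_rng.2 hux⟩
  have hlip : LipschitzWith L (fun x : s => Ψ x) := fun x y => h x.2 y.2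
  have hext : LipschitzWith L (hdense.extend fun x : s => Ψ x) := hdense.lipschitzWith_extend hlip
  refine ⟨fun x => hdense.extend (fun x : s => Ψ x) (T.orthogonalProjectionOnto x), ?_, ?_⟩
  · have := hext.comp (T.lipschitzWith_orthogonalProjectionOnto)
    rwa [mul_one] at this
  · intro x hx
    have hxT : x ∈ T := S.le_topologicalClosure hx
    have e1 : T.orthogonalProjectionOnto x = ⟨x, hxT⟩ :=
      T.orthogonalProjectionOnto_mem_subspace_eq_self ⟨x, hxT⟩
    simp only [e1]
    exact hdense.extend_eq hlip.continuous ⟨⟨x, hxT⟩, hx⟩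

/-! ### Contractive autoregressions and exponential supermartingales -/

section Chain

variable {E : Type*} [NormedAddCommGroup E] [MeasurableSpace E] {Ω : Type*}

/-- A causal autoregression `X t = Ψ (X (t - 1)) + ε t` in a Hilbert space, with identically
distributed innovations that are independent of the past and a globally contractive `Ψ`. Of
stationarity only the equality of the one-dimensional laws is recorded. -/
structure IsContractiveChain [MeasurableSpace Ω] (μ : Measure Ω) (Ψ : E → E) (L : ℝ≥0)
    (X ε : ℤ → Ω → E) : Prop where
  measurable_X : ∀ t, Measurable (X t)
  measurable_ε : ∀ t, Measurable (ε t)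
  lt_one : L < 1
  lipschitz : LipschitzWith L Ψ
  equation : ∀ᵐ ω ∂μ, ∀ t, X t ω = Ψ (X (t - 1) ω) + ε t ω
  identDistrib_ε : ∀ t, IdentDistrib (ε t) (ε 0) μ μ
  identDistrib_X : ∀ t, IdentDistrib (X t) (X 0) μ μ
  indep : ∀ t : ℤ, IndepFun (fun ω (s : Set.Iio t) => X s ω) (ε t) μ

/-- The `σ`-algebra generated by the observations strictly before time `t`. -/
@[reducible] def strictPast (X : ℤ → Ω → E) (t : ℤ) : MeasurableSpace Ω :=
  MeasurableSpace.comap (fun ω (s : Set.Iio t) => X s ω) inferInstance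

omit [NormedAddCommGroup E] in
theorem measurable_strictPast (X : ℤ → Ω → E) {s t : ℤ} (h : s < t) :
    Measurable[strictPast X t] (X s) := by
  have h1 : Measurable[strictPast X t] fun ω (s : Set.Iio t) => X s ω := comap_measurable _
  exact (measurable_pi_apply (⟨s, h⟩ : Set.Iio t)).comp h1

namespace IsContractiveChain

variable [MeasurableSpace Ω] {μ : Measure Ω} {Ψ : E → E} {L : ℝ≥0} {X ε : ℤ → Ω → E}

theorem measurable_innovation [BorelSpace E] [SecondCountableTopology E]
    (h : IsContractiveChain μ Ψ L X ε) {s t : ℤ} (hst : s < t) :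
    Measurable[strictPast X t] (fun ω => X s ω - Ψ (X (s - 1) ω)) :=
  (measurable_strictPast X hst).sub
    (h.lipschitz.continuous.measurable.comp (measurable_strictPast X (by omega)))

variable [IsProbabilityMeasure μ]

theorem isProbabilityMeasure_law (h : IsContractiveChain μ Ψ L X ε) :
    IsProbabilityMeasure (μ.map (ε 0)) :=
  Measure.isProbabilityMeasure_map (h.measurable_ε 0).aemeasurable

/-- Conditionally on the past, the innovation may be integrated out. -/
theorem lintegral_innovation (h : IsContractiveChain μ Ψ L X ε) {T : Type*} [MeasurableSpace T]
    {t : ℤ} {Y : Ω → T} (hY : Measurable[strictPast X t] Y) {G : T × E → ℝ≥0∞}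
    (hG : Measurable G) :
    ∫⁻ ω, G (Y ω, ε t ω) ∂μ = ∫⁻ ω, ∫⁻ y, G (Y ω, y) ∂(μ.map (ε 0)) ∂μ := by
  have := h.isProbabilityMeasure_law
  have hpast : strictPast X t ≤ ‹MeasurableSpace Ω› := by
    refine Measurable.comap_le ?_
    exact measurable_pi_lambda _ fun s => h.measurable_X s
  have hY' : Measurable Y := hY.mono hpast le_rfl
  have hind : IndepFun Y (ε t) μ := by
    have h1 := h.indep t
    rw [IndepFun_iff_Indep] at h1 ⊢
    exact indep_of_indep_of_le_left h1 hY.comap_le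
  have hε := h.measurable_ε t
  have h2 := (indepFun_iff_map_prod_eq_prod_map_map hY'.aemeasurable hε.aemeasurable).1 hind
  rw [(h.identDistrib_ε t).map_eq] at h2
  calc ∫⁻ ω, G (Y ω, ε t ω) ∂μ = ∫⁻ p, G p ∂(μ.map fun ω => (Y ω, ε t ω)) :=
        (lintegral_map hG (hY'.prodMk hε)).symm
    _ = ∫⁻ a, ∫⁻ y, G (a, y) ∂(μ.map (ε 0)) ∂(μ.map Y) := by
        rw [h2, lintegral_prod _ hG.aemeasurable]
    _ = _ := lintegral_map hG.lintegral_prod_right' hY'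

variable [BorelSpace E] [SecondCountableTopology E]

/-- If the multiplicative increments have conditional mean at most one, then so has their product. -/
theorem lintegral_exp_sum_le_one (h : IsContractiveChain μ Ψ L X ε) {g : E → E → ℝ}
    (hg : Measurable (Function.uncurry g)) (k₀ : ℤ)
    (hle : ∀ t, ∀ᵐ ω ∂μ, ∫⁻ y, ENNReal.ofReal (Real.exp (g (X t ω) y)) ∂(μ.map (ε 0)) ≤ 1)
    (n : ℕ) :
    ∫⁻ ω, ENNReal.ofReal (Real.exp
      (∑ k ∈ Finset.range n, g (X (k₀ + k) ω) (ε (k₀ + k + 1) ω))) ∂μ ≤ 1 := by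
  induction n with
  | zero => simp
  | succ n ih =>
    set A : Ω → ℝ := fun ω => ∑ k ∈ Finset.range n,
      g (X (k₀ + k) ω) (X (k₀ + k + 1) ω - Ψ (X (k₀ + k + 1 - 1) ω)) with hA
    have hAeq : ∀ᵐ ω ∂μ,
        ∑ k ∈ Finset.range n, g (X (k₀ + k) ω) (ε (k₀ + k + 1) ω) = A ω := by
      filter_upwards [h.equation] with ω hω
      refine Finset.sum_congr rfl fun k _ => ?_
      rw [hω (k₀ + k + 1), add_sub_cancel_left]
    have hAm : Measurable[strictPast X (k₀ + n + 1)] A := by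
      refine Finset.measurable_fun_sum _ fun k hk => ?_
      have hk' := Finset.mem_range.1 hk
      exact hg.comp ((measurable_strictPast X (by omega)).prodMk
        (h.measurable_innovation (by omega)))
    have hY : Measurable[strictPast X (k₀ + n + 1)] fun ω => (A ω, X (k₀ + n) ω) :=
      hAm.prodMk (measurable_strictPast X (by omega))
    have hG : Measurable fun p : (ℝ × E) × E =>
        ENNReal.ofReal (Real.exp (p.1.1 + g p.1.2 p.2)) := by
      have : Measurable fun p : (ℝ × E) × E => g p.1.2 p.2 :=
        hg.comp (measurable_fst.snd.prodMk measurable_snd)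
      fun_prop
    calc _ = ∫⁻ ω, ENNReal.ofReal (Real.exp
            (A ω + g (X (k₀ + n) ω) (ε (k₀ + n + 1) ω))) ∂μ := by
          refine lintegral_congr_ae ?_
          filter_upwards [hAeq] with ω hω
          rw [Finset.sum_range_succ, hω]
      _ = ∫⁻ ω, ∫⁻ y, ENNReal.ofReal (Real.exp
            (A ω + g (X (k₀ + n) ω) y)) ∂(μ.map (ε 0)) ∂μ := h.lintegral_innovation hY hG
      _ ≤ ∫⁻ ω, ENNReal.ofReal (Real.exp (A ω)) ∂μ := by
          refine lintegral_mono_ae ?_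
          filter_upwards [hle (k₀ + n)] with ω hω
          simp only [Real.exp_add, ENNReal.ofReal_mul (Real.exp_pos _).le]
          rw [lintegral_const_mul' _ _ ENNReal.ofReal_ne_top]
          exact mul_le_of_le_one_right' hω
      _ ≤ 1 := by
          refine le_trans (le_of_eq (lintegral_congr_ae ?_)) ih
          filter_upwards [hAeq] with ω hω
          rw [hω]

/-- Chernoff bound for functionals whose exponential has conditional mean at most one. -/
theorem measure_le_sum_le (h : IsContractiveChain μ Ψ L X ε) {g : E → E → ℝ}
    (hg : Measurable (Function.uncurry g)) (k₀ : ℤ)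
    (hle : ∀ t, ∀ᵐ ω ∂μ, ∫⁻ y, ENNReal.ofReal (Real.exp (g (X t ω) y)) ∂(μ.map (ε 0)) ≤ 1)
    (n : ℕ) (v : ℝ) :
    μ {ω | v ≤ ∑ k ∈ Finset.range n, g (X (k₀ + k) ω) (ε (k₀ + k + 1) ω)}
      ≤ ENNReal.ofReal (Real.exp (-v)) := by
  have h1 := h.lintegral_exp_sum_le_one hg k₀ hle n
  have hm : Measurable fun ω => ENNReal.ofReal (Real.exp
      (∑ k ∈ Finset.range n, g (X (k₀ + k) ω) (ε (k₀ + k + 1) ω))) := by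
    refine ENNReal.measurable_ofReal.comp (Real.measurable_exp.comp ?_)
    exact Finset.measurable_fun_sum _ fun k _ =>
      hg.comp ((h.measurable_X _).prodMk (h.measurable_ε _))
  have h2 := meas_ge_le_lintegral_div hm.aemeasurable
    (ε := ENNReal.ofReal (Real.exp v)) (by simp [Real.exp_pos]) ENNReal.ofReal_ne_top (μ := μ)
  calc _ ≤ μ {ω | ENNReal.ofReal (Real.exp v) ≤ ENNReal.ofReal (Real.exp
        (∑ k ∈ Finset.range n, g (X (k₀ + k) ω) (ε (k₀ + k + 1) ω)))} :=
        measure_mono fun ω hω => ENNReal.ofReal_le_ofReal (Real.exp_le_exp.2 hω)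
    _ ≤ _ := h2
    _ ≤ 1 / ENNReal.ofReal (Real.exp v) := by gcongr
    _ = _ := by
      rw [Real.exp_neg, ENNReal.ofReal_inv_of_pos (Real.exp_pos v), one_div]

end IsContractiveChain

end Chain

section Noise

variable {E : Type*} [NormedAddCommGroup E] [InnerProductSpace ℝ E] [CompleteSpace E]
  [MeasurableSpace E] [BorelSpace E] [SecondCountableTopology E]

omit [BorelSpace E] [SecondCountableTopology E] in
/-- Since the innovation is centred, the linear term of `cosh_norm_add_le` integrates to zero. -/
theorem lintegral_cosh_norm_add_smul_le
    {m : Measure E} [IsProbabilityMeasure m] {θ₀ V : ℝ} (hB : HasBernsteinBound m θ₀ V) (hint : Integrable (fun y : E => y) m)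
    (hcent : ∫ y, y ∂m = 0) {θ κ c : ℝ} (hθ : 0 ≤ θ) (hc : 0 ≤ c) (hcκ : c ≤ κ)
    (hκ : θ * κ ≤ θ₀) (s : E) :
    ∫⁻ y, ENNReal.ofReal (Real.cosh (θ * ‖s + c • y‖)) ∂m
      ≤ ENNReal.ofReal (Real.cosh (θ * ‖s‖) * Real.exp (V * θ ^ 2 * κ * c)) := by
  have hθc : 0 ≤ θ * c := mul_nonneg hθ hc
  have hθc' : θ * c ≤ θ₀ := (mul_le_mul_of_nonneg_left hcκ hθ).trans hκ
  set b : ℝ := Real.sinh (θ * ‖s‖) / (θ * ‖s‖)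
  set F : E → ℝ := fun y => Real.cosh (θ * ‖s‖) *
    (1 + (Real.exp (θ * c * ‖y‖) - 1 - θ * c * ‖y‖)) + b * inner ℝ (θ • s) ((θ * c) • y) with hF
  have hle : ∀ y, Real.cosh (θ * ‖s + c • y‖) ≤ F y := by
    intro y
    have h1 := cosh_norm_add_le (θ • s) ((θ * c) • y)
    rw [show θ • s + (θ * c) • y = θ • (s + c • y) by rw [smul_add, mul_smul], norm_smul, norm_smul,
      norm_smul, Real.norm_of_nonneg hθ, Real.norm_of_nonneg hθc] at h1
    exact h1
  have hi1 : Integrable (fun y : E => Real.exp (θ * c * ‖y‖) - 1 - θ * c * ‖y‖) m :=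
    ((hB.integrable_exp _ hθc hθc').sub (integrable_const _)).sub (hint.norm.const_mul _)
  have hi2 : Integrable (fun y : E => Real.cosh (θ * ‖s‖) *
      (1 + (Real.exp (θ * c * ‖y‖) - 1 - θ * c * ‖y‖))) m :=
    ((integrable_const (1 : ℝ)).add hi1).const_mul _
  have hi3 : Integrable (fun y : E => b * inner ℝ (θ • s) ((θ * c) • y)) m :=
    ((hint.smul (θ * c)).const_inner (θ • s)).const_mul _
  have hI : ∫ y, F y ∂m ≤ Real.cosh (θ * ‖s‖) * Real.exp (V * θ ^ 2 * κ * c) := by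
    have e3 : ∫ y : E, b * inner ℝ (θ • s) ((θ * c) • y) ∂m = 0 := by
      have h0 : ∫ y : E, inner ℝ (θ • s) ((θ * c) • y) ∂m = 0 := by
        refine (integral_inner (hint.smul (θ * c)) (θ • s)).trans ?_
        simp only [Pi.smul_apply]
        rw [integral_smul, hcent, smul_zero, inner_zero_right]
      rw [integral_const_mul, h0, mul_zero]
    rw [hF, integral_add hi2 hi3, e3, add_zero, integral_const_mul]
    refine mul_le_mul_of_nonneg_left ?_ (Real.cosh_pos _).le
    rw [integral_add (integrable_const _) hi1]
    have h4 := hB.second_order _ hθc hθc'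
    have h5 : V * (θ * c) ^ 2 ≤ V * θ ^ 2 * κ * c := by
      have hV := hB.nonneg
      calc V * (θ * c) ^ 2 = V * θ ^ 2 * c * c := by ring
        _ ≤ _ := by gcongr
    have h6 := Real.add_one_le_exp (V * θ ^ 2 * κ * c)
    simp only [integral_const, probReal_univ, one_smul]
    linarith
  calc _ ≤ ∫⁻ y, ENNReal.ofReal (F y) ∂m :=
        lintegral_mono fun y => ENNReal.ofReal_le_ofReal (hle y)
    _ = ENNReal.ofReal (∫ y, F y ∂m) :=
        (ofReal_integral_eq_lintegral_ofReal (hi2.add hi3)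
          (Eventually.of_forall fun y => (Real.cosh_pos _).le.trans (hle y))).symm
    _ ≤ _ := ENNReal.ofReal_le_ofReal hI

namespace IsContractiveChain

variable {Ω : Type*} [MeasurableSpace Ω] {μ : Measure Ω} [IsProbabilityMeasure μ] {Ψ : E → E}
  {L : ℝ≥0} {X ε : ℤ → Ω → E}

/-- The exponential supermartingale of a weighted sum of the innovations, in Hilbert space. -/
theorem lintegral_cosh_noise_le_one (h : IsContractiveChain μ Ψ L X ε) {θ₀ V : ℝ}
    (hB : HasBernsteinBound (μ.map (ε 0)) θ₀ V)
    (hint : Integrable (fun y : E => y) (μ.map (ε 0)))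
    (hcent : ∫ y, y ∂(μ.map (ε 0)) = 0) {w : E → ℝ} (hw : Measurable w) {θ κ : ℝ}
    (hw0 : ∀ x, 0 ≤ w x) (hwκ : ∀ x, w x ≤ κ) (hθ : 0 ≤ θ) (hκ : θ * κ ≤ θ₀) (k₀ : ℤ) (n : ℕ) :
    ∫⁻ ω, ENNReal.ofReal (Real.exp (-(V * θ ^ 2 * κ * ∑ k ∈ Finset.range n, w (X (k₀ + k) ω))) *
      Real.cosh (θ * ‖∑ k ∈ Finset.range n, w (X (k₀ + k) ω) • ε (k₀ + k + 1) ω‖)) ∂μ ≤ 1 := by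
  have := h.isProbabilityMeasure_law
  induction n with
  | zero => simp
  | succ n ih =>
    set A : Ω → ℝ := fun ω => ∑ k ∈ Finset.range n, w (X (k₀ + k) ω) with hA
    set N : Ω → E := fun ω => ∑ k ∈ Finset.range n,
      w (X (k₀ + k) ω) • (X (k₀ + k + 1) ω - Ψ (X (k₀ + k + 1 - 1) ω)) with hN
    have hNeq : ∀ᵐ ω ∂μ,
        ∑ k ∈ Finset.range n, w (X (k₀ + k) ω) • ε (k₀ + k + 1) ω = N ω := by
      filter_upwards [h.equation] with ω hω
      refine Finset.sum_congr rfl fun k _ => ?_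
      rw [hω (k₀ + k + 1), add_sub_cancel_left]
    have hAm : Measurable[strictPast X (k₀ + n + 1)] A := by
      refine Finset.measurable_fun_sum _ fun k hk => ?_
      have hk' := Finset.mem_range.1 hk
      exact hw.comp (measurable_strictPast X (by omega))
    have hNm : Measurable[strictPast X (k₀ + n + 1)] N := by
      refine Finset.measurable_fun_sum _ fun k hk => ?_
      have hk' := Finset.mem_range.1 hk
      exact (hw.comp (measurable_strictPast X (by omega))).smul
        (h.measurable_innovation (by omega))
    have hY : Measurable[strictPast X (k₀ + n + 1)] fun ω => ((A ω, N ω), X (k₀ + n) ω) :=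
      (hAm.prodMk hNm).prodMk (measurable_strictPast X (by omega))
    have hG : Measurable fun p : ((ℝ × E) × E) × E =>
        ENNReal.ofReal (Real.exp (-(V * θ ^ 2 * κ * (p.1.1.1 + w p.1.2))) *
          Real.cosh (θ * ‖p.1.1.2 + w p.1.2 • p.2‖)) := by
      have hc : Measurable Real.cosh := Real.continuous_cosh.measurable
      fun_prop
    calc _ = ∫⁻ ω, ENNReal.ofReal (Real.exp (-(V * θ ^ 2 * κ * (A ω + w (X (k₀ + n) ω)))) *
            Real.cosh (θ * ‖N ω + w (X (k₀ + n) ω) • ε (k₀ + n + 1) ω‖)) ∂μ := by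
          refine lintegral_congr_ae ?_
          filter_upwards [hNeq] with ω hω
          rw [Finset.sum_range_succ, Finset.sum_range_succ, hω]
      _ = ∫⁻ ω, ∫⁻ y, ENNReal.ofReal (Real.exp (-(V * θ ^ 2 * κ * (A ω + w (X (k₀ + n) ω)))) *
            Real.cosh (θ * ‖N ω + w (X (k₀ + n) ω) • y‖)) ∂(μ.map (ε 0)) ∂μ :=
          h.lintegral_innovation hY hG
      _ ≤ ∫⁻ ω, ENNReal.ofReal (Real.exp (-(V * θ ^ 2 * κ * A ω)) *
            Real.cosh (θ * ‖N ω‖)) ∂μ := by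
          refine lintegral_mono fun ω => ?_
          simp only [ENNReal.ofReal_mul (Real.exp_pos _).le]
          rw [lintegral_const_mul' _ _ ENNReal.ofReal_ne_top]
          refine (mul_le_mul_right (lintegral_cosh_norm_add_smul_le hB hint hcent hθ
            (hw0 _) (hwκ _) hκ (N ω)) _).trans (le_of_eq ?_)
          rw [← ENNReal.ofReal_mul (Real.exp_pos _).le, ← ENNReal.ofReal_mul (Real.exp_pos _).le,
            mul_comm (Real.cosh _), ← mul_assoc, ← Real.exp_add]
          congr 3
          ring
      _ ≤ 1 := by
          refine le_trans (le_of_eq (lintegral_congr_ae ?_)) ih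
          filter_upwards [hNeq] with ω hω
          rw [hω]

/-- Bernstein type inequality for weighted sums of the innovations, self-normalized by the sum of the
weights. -/
theorem measure_noise_le (h : IsContractiveChain μ Ψ L X ε) {θ₀ V : ℝ}
    (hB : HasBernsteinBound (μ.map (ε 0)) θ₀ V)
    (hint : Integrable (fun y : E => y) (μ.map (ε 0)))
    (hcent : ∫ y, y ∂(μ.map (ε 0)) = 0) {w : E → ℝ} (hw : Measurable w) {θ κ : ℝ}
    (hw0 : ∀ x, 0 ≤ w x) (hwκ : ∀ x, w x ≤ κ) (hθ : 0 ≤ θ) (hκ : θ * κ ≤ θ₀) (k₀ : ℤ) (n : ℕ)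
    (r b : ℝ) :
    μ {ω | r ≤ ‖∑ k ∈ Finset.range n, w (X (k₀ + k) ω) • ε (k₀ + k + 1) ω‖ ∧
        ∑ k ∈ Finset.range n, w (X (k₀ + k) ω) ≤ b}
      ≤ ENNReal.ofReal (2 * Real.exp (V * θ ^ 2 * κ * b - θ * r)) := by
  have h1 := h.lintegral_cosh_noise_le_one hB hint hcent hw hw0 hwκ hθ hκ k₀ n
  have hκ0 : 0 ≤ κ := (hw0 0).trans (hwκ 0)
  have hV := hB.nonneg
  have hm : Measurable fun ω => ENNReal.ofReal
      (Real.exp (-(V * θ ^ 2 * κ * ∑ k ∈ Finset.range n, w (X (k₀ + k) ω))) *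
      Real.cosh (θ * ‖∑ k ∈ Finset.range n, w (X (k₀ + k) ω) • ε (k₀ + k + 1) ω‖)) := by
    have hc : Measurable Real.cosh := Real.continuous_cosh.measurable
    have hX := h.measurable_X
    have hε := h.measurable_ε
    fun_prop
  set a : ℝ := Real.exp (θ * r - V * θ ^ 2 * κ * b) / 2 with ha
  have ha0 : 0 < a := by positivity
  have h2 := meas_ge_le_lintegral_div hm.aemeasurable
    (ε := ENNReal.ofReal a) (by simp [ha0]) ENNReal.ofReal_ne_top (μ := μ)
  refine (measure_mono fun ω hω => ?_).trans (h2.trans ?_)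
  · refine ENNReal.ofReal_le_ofReal ?_
    obtain ⟨hr, hb⟩ := hω
    rw [ha, sub_eq_neg_add, Real.exp_add, mul_div_assoc]
    gcongr
    calc Real.exp (θ * r) / 2 ≤
        Real.exp (θ * ‖∑ k ∈ Finset.range n, w (X (k₀ + k) ω) • ε (k₀ + k + 1) ω‖) / 2 := by gcongr
      _ ≤ _ := by
        rw [Real.cosh_eq]
        gcongr
        linarith [Real.exp_pos
          (-(θ * ‖∑ k ∈ Finset.range n, w (X (k₀ + k) ω) • ε (k₀ + k + 1) ω‖))]
  · calc _ ≤ 1 / ENNReal.ofReal a := by gcongr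
      _ = ENNReal.ofReal a⁻¹ := by rw [one_div, ENNReal.ofReal_inv_of_pos ha0]
      _ = _ := by
        rw [ha, inv_div, ← neg_sub (θ * r), Real.exp_neg, div_eq_mul_inv]

end IsContractiveChain

end Noise

/-! ### Summable probabilities -/

theorem tsum_ne_top_of_eventually_le {f g : ℕ → ℝ≥0∞} (hf : ∀ n, f n ≠ ⊤)
    (hle : ∀ᶠ n in atTop, f n ≤ g n) (hg : ∑' n, g n ≠ ⊤) : ∑' n, f n ≠ ⊤ := by
  obtain ⟨N, hN⟩ := eventually_atTop.1 hle
  rw [← ENNReal.summable.sum_add_tsum_nat_add' (k := N)]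
  refine ENNReal.add_ne_top.2 ⟨ENNReal.sum_ne_top.2 fun n _ => hf n, ?_⟩
  refine ne_top_of_le_ne_top hg ?_
  calc _ ≤ ∑' n, g (n + N) := ENNReal.tsum_le_tsum fun n => hN _ (by omega)
    _ ≤ _ := ENNReal.tsum_comp_le_tsum_of_injective (add_left_injective N) g

theorem tsum_ofReal_exp_neg_mul_ne_top {c : ℝ} (hc : 0 < c) :
    ∑' n : ℕ, ENNReal.ofReal (Real.exp (-(c * n))) ≠ ⊤ := by
  refine Summable.tsum_ofReal_ne_top ?_
  have := Real.summable_exp_nat_mul_iff.2 (neg_lt_zero.2 hc)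
  refine this.congr fun n => ?_
  congr 1
  ring

theorem tsum_add_ne_top {f g : ℕ → ℝ≥0∞} (hf : ∑' n, f n ≠ ⊤) (hg : ∑' n, g n ≠ ⊤) :
    ∑' n, (f n + g n) ≠ ⊤ := by
  rw [ENNReal.tsum_add]
  exact ENNReal.add_ne_top.2 ⟨hf, hg⟩

theorem exp_le_one_add_two_mul {x : ℝ} (h0 : 0 ≤ x) (h1 : x ≤ 1) : Real.exp x ≤ 1 + 2 * x := by
  have h := Real.abs_exp_sub_one_sub_id_le (x := x) (by rwa [abs_of_nonneg h0])
  have h2 := (abs_le.1 h).2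
  nlinarith

/-! ### Deviation inequalities for occupation counts -/

section Counts

variable {E : Type*} [NormedAddCommGroup E] [MeasurableSpace E] [BorelSpace E]
  [SecondCountableTopology E] {Ω : Type*} [MeasurableSpace Ω] {μ : Measure Ω}
  [IsProbabilityMeasure μ] {Ψ : E → E} {L : ℝ≥0} {X ε : ℤ → Ω → E}

namespace IsContractiveChain

omit [BorelSpace E] [SecondCountableTopology E] [IsProbabilityMeasure μ] in
theorem ae_eq_next (h : IsContractiveChain μ Ψ L X ε) (k₀ : ℤ) :
    ∀ᵐ ω ∂μ, ∀ k : ℕ, X (k₀ + k + 1) ω = Ψ (X (k₀ + k) ω) + ε (k₀ + k + 1) ω := by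
  filter_upwards [h.equation] with ω hω k
  have := hω (k₀ + k + 1)
  rwa [add_sub_cancel_right] at this

/-- Upper deviations of a sum of weights whose conditional means are at most `q`. -/
theorem measure_sum_weight_ge (h : IsContractiveChain μ Ψ L X ε) {w : E → ℝ} (hw : Measurable w)
    (hw0 : ∀ x, 0 ≤ w x) (hw1 : ∀ x, w x ≤ 1) {q : ℝ}
    (hle : ∀ t, ∀ᵐ ω ∂μ, ∫ y, w (Ψ (X t ω) + y) ∂(μ.map (ε 0)) ≤ q)
    (k₀ : ℤ) (n : ℕ) (v : ℝ) :
    μ {ω | v + 2 * n * q ≤ ∑ k ∈ Finset.range n, w (X (k₀ + k + 1) ω)}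
      ≤ ENNReal.ofReal (Real.exp (-v)) := by
  have := h.isProbabilityMeasure_law
  have hΨ := h.lipschitz.continuous.measurable
  have hg : Measurable (Function.uncurry fun x y => w (Ψ x + y) - 2 * q) := by
    simp only [Function.uncurry_def]
    fun_prop
  have key := h.measure_le_sum_le hg k₀ (fun t => by
    filter_upwards [hle t] with ω hω
    have hwm : Measurable fun y => w (Ψ (X t ω) + y) := by fun_prop
    have hi : Integrable (fun y => w (Ψ (X t ω) + y)) (μ.map (ε 0)) :=
      Integrable.of_bound (C := 1) hwm.aestronglyMeasurable (Eventually.of_forall fun y => by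
        rw [Real.norm_of_nonneg (hw0 _)]; exact hw1 _)
    have hi2 : Integrable (fun y => 1 + 2 * w (Ψ (X t ω) + y)) (μ.map (ε 0)) :=
      (integrable_const _).add (hi.const_mul 2)
    calc ∫⁻ y, ENNReal.ofReal (Real.exp (w (Ψ (X t ω) + y) - 2 * q)) ∂(μ.map (ε 0))
        ≤ ∫⁻ y, ENNReal.ofReal (Real.exp (-(2 * q)) * (1 + 2 * w (Ψ (X t ω) + y))) ∂(μ.map (ε 0)) := by
          refine lintegral_mono fun y => ENNReal.ofReal_le_ofReal ?_
          rw [sub_eq_neg_add, Real.exp_add]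
          gcongr
          exact exp_le_one_add_two_mul (hw0 _) (hw1 _)
      _ = ENNReal.ofReal (∫ y, Real.exp (-(2 * q)) * (1 + 2 * w (Ψ (X t ω) + y)) ∂(μ.map (ε 0))) :=
          (ofReal_integral_eq_lintegral_ofReal (hi2.const_mul _)
            (Eventually.of_forall fun y => by have := hw0 (Ψ (X t ω) + y); positivity)).symm
      _ ≤ 1 := by
          rw [← ENNReal.ofReal_one]
          refine ENNReal.ofReal_le_ofReal ?_
          rw [integral_const_mul, integral_add (integrable_const _) (hi.const_mul 2),
            integral_const_mul]
          simp only [integral_const, probReal_univ, one_smul]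
          calc _ ≤ Real.exp (-(2 * q)) * Real.exp (2 * q) := by
                gcongr
                linarith [Real.add_one_le_exp (2 * q)]
            _ = 1 := by rw [← Real.exp_add]; simp) n v
  refine (measure_mono_ae ?_).trans key
  filter_upwards [h.ae_eq_next k₀] with ω hω hle'
  change v + 2 * n * q ≤ _ at hle'
  change v ≤ _
  simp only [hω] at hle'
  rw [Finset.sum_sub_distrib, Finset.sum_const, Finset.card_range, nsmul_eq_mul]
  linarith

/-- Upper deviations of weighted sums of the norms of the innovations. -/
theorem measure_sum_weight_norm_ge (h : IsContractiveChain μ Ψ L X ε) {θ₀ V : ℝ}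
    (hB : HasBernsteinBound (μ.map (ε 0)) θ₀ V) {w : E → ℝ} (hw : Measurable w)
    (hw0 : ∀ x, 0 ≤ w x) (hw1 : ∀ x, w x ≤ 1) (k₀ : ℤ) (n : ℕ) (b v : ℝ) :
    μ {ω | θ₀⁻¹ * v + V * b ≤ ∑ k ∈ Finset.range n, w (X (k₀ + k) ω) * ‖ε (k₀ + k + 1) ω‖ ∧
        ∑ k ∈ Finset.range n, w (X (k₀ + k) ω) ≤ b}
      ≤ ENNReal.ofReal (Real.exp (-v)) := by
  have hθ := hB.pos
  have hV := hB.nonneg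
  have hg : Measurable (Function.uncurry fun (x y : E) => θ₀ * (w x * ‖y‖) - V * θ₀ * w x) := by
    simp only [Function.uncurry_def]
    fun_prop
  have key := h.measure_le_sum_le hg k₀ (fun t => by
    refine Eventually.of_forall fun ω => ?_
    set c := w (X t ω)
    have hc : θ₀ * c ≤ θ₀ := mul_le_of_le_one_right hθ.le (hw1 _)
    have hc0 : 0 ≤ θ₀ * c := mul_nonneg hθ.le (hw0 _)
    calc ∫⁻ y, ENNReal.ofReal (Real.exp (θ₀ * (c * ‖y‖) - V * θ₀ * c)) ∂(μ.map (ε 0))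
        = ∫⁻ y, ENNReal.ofReal (Real.exp (-(V * θ₀ * c)) * Real.exp (θ₀ * c * ‖y‖))
            ∂(μ.map (ε 0)) := by
          refine lintegral_congr fun y => ?_
          rw [← Real.exp_add]
          congr 2
          ring
      _ = ENNReal.ofReal (∫ y, Real.exp (-(V * θ₀ * c)) * Real.exp (θ₀ * c * ‖y‖)
            ∂(μ.map (ε 0))) :=
          (ofReal_integral_eq_lintegral_ofReal ((hB.integrable_exp _ hc0 hc).const_mul _)
            (Eventually.of_forall fun y => by positivity)).symm
      _ ≤ 1 := by
          rw [← ENNReal.ofReal_one]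
          refine ENNReal.ofReal_le_ofReal ?_
          rw [integral_const_mul]
          calc _ ≤ Real.exp (-(V * θ₀ * c)) * Real.exp (V * θ₀ * c) := by
                gcongr
                refine (hB.first_order _ hc0 hc).trans ?_
                linarith [Real.add_one_le_exp (V * θ₀ * c)]
            _ = 1 := by rw [← Real.exp_add]; simp) n v
  refine (measure_mono fun ω hω => ?_).trans key
  obtain ⟨h1, h2⟩ := hω
  change v ≤ _
  rw [Finset.sum_sub_distrib, ← Finset.mul_sum, ← Finset.mul_sum]
  have h3 := mul_le_mul_of_nonneg_left h1 hθ.le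
  have h4 := mul_le_mul_of_nonneg_left h2 (mul_nonneg hV hθ.le)
  rw [mul_add, mul_inv_cancel_left₀ hθ.ne'] at h3
  linarith

/-- Lower deviations: if from `B` the chain moves to `A` with probability at least `β`, then many visits
to `B` entail many visits to `A`. -/
theorem measure_visits_le (h : IsContractiveChain μ Ψ L X ε) {A B : Set E} (hA : MeasurableSet A)
    (hBm : MeasurableSet B) {β : ℝ}
    (hle : ∀ t, ∀ᵐ ω ∂μ, X t ω ∈ B → β ≤ (μ.map (ε 0)).real {y | Ψ (X t ω) + y ∈ A})
    (k₀ : ℤ) (n : ℕ) (a v : ℝ) :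
    μ {ω | ∑ k ∈ Finset.range n, A.indicator (fun _ => (1 : ℝ)) (X (k₀ + k + 1) ω) ≤ a ∧
        2 * (a + v) ≤ β * ∑ k ∈ Finset.range n, B.indicator (fun _ => (1 : ℝ)) (X (k₀ + k) ω)}
      ≤ ENNReal.ofReal (Real.exp (-v)) := by
  have := h.isProbabilityMeasure_law
  have hΨ := h.lipschitz.continuous.measurable
  set iA : E → ℝ := A.indicator fun _ => (1 : ℝ)
  set iB : E → ℝ := B.indicator fun _ => (1 : ℝ)
  have hiA : Measurable iA := measurable_const.indicator hA
  have hiB : Measurable iB := measurable_const.indicator hBm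
  have hA01 : ∀ x, iA x = 0 ∨ iA x = 1 := fun x => by
    by_cases hx : x ∈ A <;> simp [iA, hx]
  have hg : Measurable (Function.uncurry fun (x y : E) => β / 2 * iB x - iA (Ψ x + y)) := by
    simp only [Function.uncurry_def]
    fun_prop
  have key := h.measure_le_sum_le hg k₀ (fun t => by
    filter_upwards [hle t] with ω hω
    set s : Set E := {y | Ψ (X t ω) + y ∈ A} with hs
    have hsm : MeasurableSet s := by
      have : Measurable fun y => Ψ (X t ω) + y := by fun_prop
      exact this hA
    have hi0 : Integrable (s.indicator fun _ => (1 : ℝ)) (μ.map (ε 0)) :=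
      (integrable_const _).indicator hsm
    have hi : Integrable (fun y => 1 - 1 / 2 * s.indicator (fun _ => (1 : ℝ)) y) (μ.map (ε 0)) :=
      (integrable_const _).sub (hi0.const_mul _)
    have hs01 : ∀ y, s.indicator (fun _ => (1 : ℝ)) y = iA (Ψ (X t ω) + y) := fun y => rfl
    calc ∫⁻ y, ENNReal.ofReal (Real.exp (β / 2 * iB (X t ω) - iA (Ψ (X t ω) + y))) ∂(μ.map (ε 0))
        ≤ ∫⁻ y, ENNReal.ofReal (Real.exp (β / 2 * iB (X t ω)) *
            (1 - 1 / 2 * s.indicator (fun _ => (1 : ℝ)) y)) ∂(μ.map (ε 0)) := by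
          refine lintegral_mono fun y => ENNReal.ofReal_le_ofReal ?_
          rw [sub_eq_add_neg, Real.exp_add, hs01]
          gcongr
          rcases hA01 (Ψ (X t ω) + y) with h0 | h0 <;> rw [h0]
          · simp
          · have := Real.exp_one_gt_d9
            rw [Real.exp_neg, inv_le_comm₀ (Real.exp_pos _) (by norm_num)]
            norm_num
            linarith
      _ = ENNReal.ofReal (∫ y, Real.exp (β / 2 * iB (X t ω)) *
            (1 - 1 / 2 * s.indicator (fun _ => (1 : ℝ)) y) ∂(μ.map (ε 0))) :=
          (ofReal_integral_eq_lintegral_ofReal (hi.const_mul _)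
            (Eventually.of_forall fun y => by
              simp only [Pi.zero_apply, hs01]
              refine mul_nonneg (Real.exp_pos _).le ?_
              rcases hA01 (Ψ (X t ω) + y) with h0 | h0 <;> rw [h0] <;> norm_num)).symm
      _ ≤ 1 := by
          rw [← ENNReal.ofReal_one]
          refine ENNReal.ofReal_le_ofReal ?_
          rw [integral_const_mul, integral_sub (integrable_const _) (hi0.const_mul _),
            integral_const_mul, integral_indicator_const _ hsm]
          simp only [integral_const, probReal_univ, smul_eq_mul, mul_one]
          have hβ : β * iB (X t ω) ≤ (μ.map (ε 0)).real s := by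
            by_cases hx : X t ω ∈ B
            · simpa [iB, hx] using hω hx
            · simp [iB, hx]
          calc _ ≤ Real.exp (β / 2 * iB (X t ω)) * Real.exp (-(β / 2 * iB (X t ω))) := by
                gcongr
                linarith [Real.add_one_le_exp (-(β / 2 * iB (X t ω)))]
            _ = 1 := by rw [← Real.exp_add]; simp) n v
  refine (measure_mono_ae ?_).trans key
  filter_upwards [h.ae_eq_next k₀] with ω hω hle'
  obtain ⟨h1, h2⟩ := hle'
  change v ≤ _
  simp only [hω] at h1
  rw [Finset.sum_sub_distrib, ← Finset.mul_sum]
  linarith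

end IsContractiveChain

end Counts

/-! ### Linear visit counts -/

section Visits

variable {E : Type*} [NormedAddCommGroup E] {Ω : Type*} [MeasurableSpace Ω]

/-- The process visits `A` linearly often, outside events of summable probability. -/
def VisitsLinearly (μ : Measure Ω) (X : ℤ → Ω → E) (A : Set E) : Prop :=
  ∃ c > 0, ∑' n : ℕ, μ {ω | ∑ k ∈ Finset.range n, A.indicator (fun _ => (1 : ℝ)) (X k ω) < c * n} ≠ ⊤

omit [NormedAddCommGroup E] in
theorem VisitsLinearly.mono {μ : Measure Ω} [IsFiniteMeasure μ] {X : ℤ → Ω → E} {A B : Set E}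
    (h : VisitsLinearly μ X A) (hAB : A ⊆ B) : VisitsLinearly μ X B := by
  obtain ⟨c, hc, hs⟩ := h
  refine ⟨c, hc, tsum_ne_top_of_eventually_le (fun n => measure_ne_top _ _)
    (Eventually.of_forall fun n => measure_mono fun ω hω => ?_) hs⟩
  simp only [Set.mem_ofPred_eq] at hω ⊢
  refine lt_of_le_of_lt (Finset.sum_le_sum fun k _ => ?_) hω
  exact Set.indicator_le_indicator_of_subset hAB (fun _ => zero_le_one) _

variable [MeasurableSpace E] {μ : Measure Ω} [IsProbabilityMeasure μ] {Ψ : E → E} {L : ℝ≥0}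
  {X ε : ℤ → Ω → E}

namespace IsContractiveChain

omit [IsProbabilityMeasure μ] in
theorem ae_norm_le (h : IsContractiveChain μ Ψ L X ε) :
    ∀ᵐ ω ∂μ, ∀ t, ‖X (t + 1) ω‖ ≤ L * ‖X t ω‖ + (‖Ψ 0‖ + ‖ε (t + 1) ω‖) := by
  filter_upwards [h.equation] with ω hω t
  have h1 := hω (t + 1)
  rw [add_sub_cancel_right] at h1
  have h2 := h.lipschitz.dist_le_mul (X t ω) 0
  rw [dist_eq_norm, dist_eq_norm, sub_zero] at h2
  calc ‖X (t + 1) ω‖ = ‖(Ψ (X t ω) - Ψ 0) + (Ψ 0 + ε (t + 1) ω)‖ := by rw [h1]; congr 1; abel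
    _ ≤ ‖Ψ (X t ω) - Ψ 0‖ + (‖Ψ 0‖ + ‖ε (t + 1) ω‖) :=
        (norm_add_le _ _).trans (by gcongr; exact norm_add_le _ _)
    _ ≤ _ := by gcongr

variable [BorelSpace E]

/-- Far in the past the chain is eventually forgotten, at least along a sequence of times: this needs
no moments, only the tightness that comes with stationarity. -/
theorem ae_exists_pow_mul_norm_lt (h : IsContractiveChain μ Ψ L X ε) :
    ∀ᵐ ω ∂μ, ∀ δ > 0, ∀ m₀ : ℕ, ∃ m ≥ m₀, (L : ℝ) ^ m * ‖X (-m) ω‖ < δ := by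
  have hL1 : (L : ℝ) < 1 := by exact_mod_cast h.lt_one
  have hsmall : ∀ δ > 0, Tendsto (fun m : ℕ => μ {ω | δ ≤ (L : ℝ) ^ m * ‖X (-m) ω‖}) atTop
      (𝓝 0) := by
    intro δ hδ
    have e : ∀ m : ℕ, μ {ω | δ ≤ (L : ℝ) ^ m * ‖X (-m) ω‖} =
        μ {ω | δ ≤ (L : ℝ) ^ m * ‖X 0 ω‖} := fun m =>
      (h.identDistrib_X (-m)).measure_mem_eq
        (s := {x | δ ≤ (L : ℝ) ^ m * ‖x‖}) (measurableSet_le measurable_const (by fun_prop))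
    simp only [e]
    have hempty : ⋂ m : ℕ, {ω | δ ≤ (L : ℝ) ^ m * ‖X 0 ω‖} = ∅ := by
      refine Set.eq_empty_iff_forall_notMem.2 fun ω hω => ?_
      have h1 : Tendsto (fun m : ℕ => (L : ℝ) ^ m * ‖X 0 ω‖) atTop (𝓝 (0 * ‖X 0 ω‖)) :=
        (tendsto_pow_atTop_nhds_zero_of_lt_one L.2 hL1).mul_const _
      rw [zero_mul] at h1
      obtain ⟨m, hm⟩ := (h1.eventually_lt_const hδ).exists
      exact absurd (Set.mem_iInter.1 hω m) (not_le.2 hm)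
    have hX := h.measurable_X 0
    have := tendsto_measure_iInter_atTop (μ := μ)
      (s := fun m : ℕ => {ω | δ ≤ (L : ℝ) ^ m * ‖X 0 ω‖})
      (fun m => (measurableSet_le measurable_const (by fun_prop)).nullMeasurableSet)
      (fun m m' hmm ω hω => le_trans (show δ ≤ _ from hω)
        (mul_le_mul_of_nonneg_right (pow_le_pow_of_le_one L.2 hL1.le hmm) (norm_nonneg _)))
      ⟨0, measure_ne_top _ _⟩
    rwa [hempty, measure_empty] at this
  have hall : ∀ᵐ ω ∂μ, ∀ j m₀ : ℕ, ∃ m ≥ m₀, (L : ℝ) ^ m * ‖X (-m) ω‖ < 1 / ((j : ℝ) + 1) := by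
    rw [ae_all_iff]
    intro j
    rw [ae_all_iff]
    intro m₀
    have hj : (0 : ℝ) < 1 / ((j : ℝ) + 1) := by positivity
    rw [ae_iff, ← nonpos_iff_eq_zero]
    refine ge_of_tendsto (hsmall _ hj) ?_
    filter_upwards [eventually_ge_atTop m₀] with m hm
    refine measure_mono fun ω hω => ?_
    simp only [not_exists, not_and, not_lt, Set.mem_ofPred_eq] at hω ⊢
    exact hω m hm
  filter_upwards [hall] with ω hω δ hδ m₀
  obtain ⟨j, hj⟩ := exists_nat_one_div_lt hδ
  obtain ⟨m, hm, hlt⟩ := hω j m₀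
  exact ⟨m, hm, hlt.trans hj⟩

/-- The stationary law has a first moment: iterating the contraction bounds `‖X 0‖` by a geometric sum of
past innovations, up to a term that is below one for some number of iterations. -/
theorem lintegral_enorm_ne_top (h : IsContractiveChain μ Ψ L X ε)
    (hint : ∫⁻ ω, ‖ε 0 ω‖ₑ ∂μ ≠ ⊤) : ∫⁻ ω, ‖X 0 ω‖ₑ ∂μ ≠ ⊤ := by
  have hb : ∀ᵐ ω ∂μ, ‖X 0 ω‖ₑ ≤ 1 + ∑' j : ℕ, (L : ℝ≥0∞) ^ j * (‖Ψ 0‖ₑ + ‖ε (-j) ω‖ₑ) := by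
    filter_upwards [h.ae_norm_le, h.ae_exists_pow_mul_norm_lt] with ω hω hω2
    have step : ∀ t, ‖X (t + 1) ω‖ₑ ≤ L * ‖X t ω‖ₑ + (‖Ψ 0‖ₑ + ‖ε (t + 1) ω‖ₑ) := by
      intro t
      have h1 := ENNReal.ofReal_le_ofReal (hω t)
      rwa [ENNReal.ofReal_add (by positivity) (by positivity), ENNReal.ofReal_mul L.coe_nonneg,
        ENNReal.ofReal_add (by positivity) (by positivity), ofReal_norm, ofReal_norm, ofReal_norm,
        ofReal_norm, ENNReal.ofReal_coe_nnreal] at h1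
    have hind : ∀ m : ℕ, ‖X 0 ω‖ₑ ≤ (L : ℝ≥0∞) ^ m * ‖X (-m) ω‖ₑ +
        ∑ j ∈ Finset.range m, (L : ℝ≥0∞) ^ j * (‖Ψ 0‖ₑ + ‖ε (-j) ω‖ₑ) := by
      intro m
      induction m with
      | zero => simp
      | succ m ih =>
        refine ih.trans ?_
        have h1 := step (-((m + 1 : ℕ) : ℤ))
        rw [show -((m + 1 : ℕ) : ℤ) + 1 = -(m : ℤ) by push_cast; ring] at h1
        rw [Finset.sum_range_succ, pow_succ]
        calc _ ≤ (L : ℝ≥0∞) ^ m * (L * ‖X (-((m + 1 : ℕ) : ℤ)) ω‖ₑ + (‖Ψ 0‖ₑ + ‖ε (-m) ω‖ₑ)) + _ := by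
              gcongr
          _ = _ := by ring
    obtain ⟨m, -, hm⟩ := hω2 1 one_pos 0
    refine (hind m).trans (add_le_add ?_ (ENNReal.sum_le_tsum _))
    have h1 := ENNReal.ofReal_le_ofReal hm.le
    rwa [ENNReal.ofReal_mul (by positivity), ENNReal.ofReal_pow L.coe_nonneg, ofReal_norm,
      ENNReal.ofReal_coe_nnreal, ENNReal.ofReal_one] at h1
  refine ne_top_of_le_ne_top ?_ (lintegral_mono_ae hb)
  have hm : ∀ j : ℕ, Measurable fun ω => (L : ℝ≥0∞) ^ j * (‖Ψ 0‖ₑ + ‖ε (-j) ω‖ₑ) := fun j => by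
    have := h.measurable_ε (-j)
    fun_prop
  rw [lintegral_add_left measurable_const, lintegral_tsum fun j => (hm j).aemeasurable]
  have e : ∀ j : ℕ, ∫⁻ ω, (L : ℝ≥0∞) ^ j * (‖Ψ 0‖ₑ + ‖ε (-j) ω‖ₑ) ∂μ =
      (L : ℝ≥0∞) ^ j * (‖Ψ 0‖ₑ + ∫⁻ ω, ‖ε 0 ω‖ₑ ∂μ) := by
    intro j
    have hε := h.measurable_ε (-j)
    rw [lintegral_const_mul _ (by fun_prop), lintegral_add_left measurable_const]
    simp only [lintegral_const, measure_univ, mul_one]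
    congr 2
    exact ((h.identDistrib_ε (-j)).comp measurable_enorm).lintegral_eq
  simp only [e, lintegral_const, measure_univ, mul_one]
  rw [ENNReal.tsum_mul_right, ENNReal.tsum_geometric]
  refine ENNReal.add_ne_top.2 ⟨ENNReal.one_ne_top, ENNReal.mul_ne_top ?_
    (ENNReal.add_ne_top.2 ⟨enorm_ne_top, hint⟩)⟩
  rw [ENNReal.inv_ne_top]
  exact (tsub_pos_of_lt (by exact_mod_cast h.lt_one)).ne'

omit [BorelSpace E] [IsProbabilityMeasure μ] in
theorem ae_sum_norm_le (h : IsContractiveChain μ Ψ L X ε) :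
    ∀ᵐ ω ∂μ, ∀ n : ℕ, (1 - (L : ℝ)) * ∑ k ∈ Finset.range n, ‖X k ω‖ ≤
      ‖X 0 ω‖ + n * ‖Ψ 0‖ + ∑ k ∈ Finset.range n, ‖ε (k + 1) ω‖ := by
  filter_upwards [h.ae_norm_le] with ω hω n
  have key : (1 - (L : ℝ)) * ∑ k ∈ Finset.range n, ‖X k ω‖ + ‖X n ω‖ ≤
      ‖X 0 ω‖ + n * ‖Ψ 0‖ + ∑ k ∈ Finset.range n, ‖ε (k + 1) ω‖ := by
    induction n with
    | zero => simp
    | succ n ih =>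
      rw [Finset.sum_range_succ, Finset.sum_range_succ]
      have := hω n
      push_cast at this ⊢
      linarith
  linarith [norm_nonneg (X n ω)]

/-- Some ball around the origin is visited linearly often, because by contraction the average of `‖X k‖`
is controlled by the average of the norms of the innovations. -/
theorem exists_visitsLinearly_ball [SecondCountableTopology E] (h : IsContractiveChain μ Ψ L X ε)
    {θ₀ V : ℝ} (hB : HasBernsteinBound (μ.map (ε 0)) θ₀ V) (hint : Integrable (ε 0) μ) :
    ∃ R, VisitsLinearly μ X (Metric.ball 0 R) := by
  have hL1 : (L : ℝ) < 1 := by exact_mod_cast h.lt_one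
  have hθ := hB.pos
  have hV := hB.nonneg
  set C : ℝ := θ₀⁻¹ + V with hC
  have hC0 : 0 ≤ C := by positivity
  set R : ℝ := 2 * (1 + ‖Ψ 0‖ + C) / (1 - L) with hR
  have hR0 : 0 < R := div_pos (by positivity) (by linarith)
  refine ⟨R, 1 / 2, by norm_num, ?_⟩
  have hX0 : ∑' n : ℕ, μ {ω | ‖X 0 ω‖ ∈ Set.Ioi (n : ℝ)} ≠ ⊤ := by
    have hi : Integrable (fun ω => ‖X 0 ω‖) μ := by
      have := h.measurable_X 0
      refine ⟨Measurable.aestronglyMeasurable (by fun_prop), ?_⟩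
      simp only [HasFiniteIntegral, enorm_norm]
      exact (h.lintegral_enorm_ne_top hint.2.ne).lt_top
    let : MeasureSpace Ω := ⟨μ⟩
    exact (ProbabilityTheory.tsum_prob_mem_Ioi_lt_top hi fun ω => norm_nonneg _).ne
  refine tsum_ne_top_of_eventually_le (fun n => measure_ne_top _ _)
    (Eventually.of_forall fun n => ?_)
    (tsum_add_ne_top hX0 (tsum_ofReal_exp_neg_mul_ne_top one_pos))
  have h2 := h.measure_sum_weight_norm_ge hB (w := fun _ => 1) measurable_const
    (fun _ => zero_le_one) (fun _ => le_rfl) 0 n n n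
  rw [one_mul]
  refine (measure_mono_ae ?_).trans ((measure_union_le _ _).trans (add_le_add_right h2 _))
  filter_upwards [h.ae_sum_norm_le] with ω hω hlt
  change _ < _ at hlt
  change ω ∈ (_ : Set Ω) ∪ _
  by_contra hcon
  simp only [Set.mem_union, Set.mem_ofPred_eq, Set.mem_Ioi, not_or, not_lt, not_and, zero_add,
    one_mul, Finset.sum_const, Finset.card_range, nsmul_eq_mul, mul_one, le_refl, not_true,
    imp_false, not_le] at hcon
  have h3 := hω n
  have h4 : ∀ x : E, 1 - (Metric.ball (0 : E) R).indicator (fun _ => (1 : ℝ)) x ≤ ‖x‖ / R := by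
    intro x
    by_cases hx : x ∈ Metric.ball (0 : E) R
    · simp only [hx, Set.indicator_of_mem, sub_self]; positivity
    · simp only [hx, not_false_eq_true, Set.indicator_of_notMem, sub_zero]
      rw [one_le_div hR0]
      simpa using hx
  have h5 := Finset.sum_le_sum fun k (_ : k ∈ Finset.range n) => h4 (X k ω)
  rw [Finset.sum_sub_distrib, ← Finset.sum_div] at h5
  simp only [Finset.sum_const, Finset.card_range, nsmul_eq_mul, mul_one] at h5
  have h6 : (∑ k ∈ Finset.range n, ‖X k ω‖) / R ≤ 1 / 2 * n := by
    rw [div_le_iff₀ hR0, hR, ← mul_le_mul_iff_right₀ (show 0 < 1 - (L : ℝ) by linarith)]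
    have e : (1 - (L : ℝ)) * (1 / 2 * n * (2 * (1 + ‖Ψ 0‖ + C) / (1 - L))) =
        n * (1 + ‖Ψ 0‖ + C) := by
      have : 1 - (L : ℝ) ≠ 0 := by linarith
      field_simp
    rw [e]
    have h7 := hcon.2
    rw [← add_mul, ← hC] at h7
    linarith [hcon.1]
  linarith

/-- Linear visit counts are inherited along transitions of uniformly positive probability. -/
theorem visitsLinearly_of_transition [SecondCountableTopology E]
    (h : IsContractiveChain μ Ψ L X ε) {A B : Set E} (hA : MeasurableSet A) (hBm : MeasurableSet B)
    {β : ℝ} (hβ : 0 < β) (hle : ∀ x ∈ B, β ≤ (μ.map (ε 0)).real {y | Ψ x + y ∈ A})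
    (hv : VisitsLinearly μ X B) : VisitsLinearly μ X A := by
  obtain ⟨c, hc, hs⟩ := hv
  -- The Chernoff bound needs `2 * (2 * c' + c') ≤ β * c`; the first `2 * c'` instead of `c'` makes room for
  -- the shift of time by one.
  set c' : ℝ := β * c / 8 with hc'
  have hc0 : 0 < c' := by positivity
  refine ⟨c', hc0, ?_⟩
  obtain ⟨N, hN⟩ := exists_nat_ge (1 / c')
  refine tsum_ne_top_of_eventually_le (fun n => measure_ne_top _ _) ?_
    (tsum_add_ne_top hs (tsum_ofReal_exp_neg_mul_ne_top hc0))
  filter_upwards [eventually_ge_atTop N] with n hn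
  have hn1 : 1 ≤ c' * n := by
    have : 1 / c' ≤ n := hN.trans (by exact_mod_cast hn)
    rw [div_le_iff₀ hc0] at this
    linarith
  have h2 := h.measure_visits_le hA hBm (fun t => Eventually.of_forall fun ω => hle (X t ω)) 0 n
    (2 * (c' * n)) (c' * n)
  refine (measure_mono fun ω hlt => ?_).trans ((measure_union_le _ _).trans (add_le_add_right h2 _))
  by_contra hcon
  simp only [Set.mem_union, Set.mem_ofPred_eq, not_or, not_lt, not_and, zero_add, not_le]
    at hcon hlt
  obtain ⟨h3, h4⟩ := hcon
  set f : ℕ → ℝ := fun k => A.indicator (fun _ => (1 : ℝ)) (X k ω) with hf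
  have hf01 : ∀ k, 0 ≤ f k ∧ f k ≤ 1 := fun k => by
    by_cases hx : X k ω ∈ A <;> simp [hf, hx]
  have h5 : ∑ k ∈ Finset.range n, f (k + 1) ≤ ∑ k ∈ Finset.range n, f k + 1 := by
    have e1 := Finset.sum_range_succ f n
    have e2 := Finset.sum_range_succ' f n
    linarith [(hf01 n).2, (hf01 0).1]
  have h6 := h4 (by
    have : ∑ k ∈ Finset.range n, A.indicator (fun _ => (1 : ℝ)) (X ((k : ℤ) + 1) ω) =
        ∑ k ∈ Finset.range n, f (k + 1) := by simp [hf]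
    rw [this]
    linarith)
  have h7 := mul_le_mul_of_nonneg_left h3 hβ.le
  have h8 : β * (c * n) = 8 * (c' * n) := by rw [hc']; ring
  linarith

/-- Almost every point of the trajectory has all its neighbourhoods visited linearly often: follow the
innovations that led to it, starting so far back that the starting point is forgotten. -/
theorem ae_visitsLinearly_ball [SecondCountableTopology E] (h : IsContractiveChain μ Ψ L X ε)
    {θ₀ V : ℝ} (hB : HasBernsteinBound (μ.map (ε 0)) θ₀ V) (hint : Integrable (ε 0) μ) :
    ∀ᵐ ω ∂μ, ∀ δ > 0, VisitsLinearly μ X (Metric.ball (X 0 ω) δ) := by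
  have hL1 : (L : ℝ) < 1 := by exact_mod_cast h.lt_one
  have := h.isProbabilityMeasure_law
  obtain ⟨R, hR⟩ := h.exists_visitsLinearly_ball hB hint
  have hsupp : ∀ᵐ ω ∂μ, ∀ t, ε t ω ∈ (μ.map (ε 0)).support := by
    rw [ae_all_iff]
    intro t
    have h1 : ∀ᵐ y ∂(μ.map (ε t)), y ∈ (μ.map (ε t)).support := Measure.support_mem_ae
    rw [(h.identDistrib_ε t).map_eq] at h1
    rw [← (h.identDistrib_ε t).map_eq] at h1
    have h2 := ae_of_ae_map (h.measurable_ε t).aemeasurable h1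
    rwa [(h.identDistrib_ε t).map_eq] at h2
  filter_upwards [h.equation, hsupp, h.ae_exists_pow_mul_norm_lt] with ω heq hω hpast δ hδ
  set η : ℝ := δ / 3 * (1 - L) with hη
  have hη0 : 0 < η := mul_pos (by positivity) (by linarith)
  obtain ⟨m₀, hm₀⟩ : ∃ m₀ : ℕ, ∀ m ≥ m₀, (L : ℝ) ^ m * |R| < δ / 3 := by
    have h1 : Tendsto (fun m : ℕ => (L : ℝ) ^ m * |R|) atTop (𝓝 (0 * |R|)) :=
      (tendsto_pow_atTop_nhds_zero_of_lt_one L.2 hL1).mul_const _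
    rw [zero_mul] at h1
    exact eventually_atTop.1 (h1.eventually_lt_const (by positivity))
  obtain ⟨m, hm, hXm⟩ := hpast (δ / 3) (by positivity) m₀
  set ρ : ℝ := ‖X (-m) ω‖ + |R| with hρ
  -- The radii satisfy `r (j + 1) = L * r j + η`, and their limit is `δ / 3`.
  have hstep : ∀ j : ℕ, VisitsLinearly μ X
      (Metric.ball (X (-m + j) ω) ((L : ℝ) ^ j * ρ + δ / 3)) := by
    intro j
    induction j with
    | zero =>
      refine hR.mono fun x hx => ?_
      simp only [Nat.cast_zero, add_zero, pow_zero, one_mul, Metric.mem_ball, dist_eq_norm,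
        sub_zero] at hx ⊢
      calc _ ≤ ‖x‖ + ‖X (-m) ω‖ := norm_sub_le _ _
        _ < _ := by linarith [le_abs_self R]
    | succ j ih =>
      have hpos : 0 < (μ.map (ε 0)) (Metric.ball (ε (-m + (j + 1 : ℕ)) ω) η) :=
        (Measure.mem_support_iff_forall _).1 (hω _) _ (Metric.ball_mem_nhds _ hη0)
      have hreal : 0 < (μ.map (ε 0)).real (Metric.ball (ε (-m + (j + 1 : ℕ)) ω) η) :=
        ENNReal.toReal_pos hpos.ne' (measure_ne_top _ _)
      refine h.visitsLinearly_of_transition measurableSet_ball measurableSet_ball hreal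
        (fun x hx => ?_) ih
      refine measureReal_mono fun y hy => ?_
      have e1 := heq (-m + (j + 1 : ℕ))
      rw [show -(m : ℤ) + (j + 1 : ℕ) - 1 = -m + j by push_cast; ring] at e1
      change dist (Ψ x + y) _ < _
      rw [Metric.mem_ball] at hx hy
      have h3 := h.lipschitz.dist_le_mul x (X (-m + j) ω)
      calc dist (Ψ x + y) (X (-m + (j + 1 : ℕ)) ω)
          ≤ dist (Ψ x) (Ψ (X (-m + j) ω)) + dist y (ε (-m + (j + 1 : ℕ)) ω) := by
            rw [e1]; exact dist_add_add_le _ _ _ _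
        _ < L * ((L : ℝ) ^ j * ρ + δ / 3) + η := by
            refine add_lt_add_of_le_of_lt (h3.trans ?_) hy
            gcongr
        _ = _ := by rw [hη]; ring
  refine (hstep m).mono ?_
  rw [neg_add_cancel]
  refine Metric.ball_subset_ball ?_
  rw [hρ, mul_add]
  linarith [hm₀ m hm]

end IsContractiveChain

end Visits

/-! ### Kernels -/

namespace IsKernel

variable {K : ℝ → ℝ}

theorem antitoneOn (hK : IsKernel K) : AntitoneOn K (Set.Icc 0 1) := by
  have hd : DifferentiableOn ℝ K (Set.Icc 0 1) := hK.contDiffOn.differentiableOn one_ne_zero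
  refine antitoneOn_of_deriv_nonpos (convex_Icc 0 1) hd.continuousOn
    (hd.mono interior_subset) fun x hx => ?_
  have h1 := hK.deriv_nonpos x (interior_subset hx)
  rwa [derivWithin_of_mem_nhds (mem_interior_iff_mem_nhds.1 hx)] at h1

theorem one_le (hK : IsKernel K) {s : ℝ} (h0 : 0 ≤ s) (h1 : s ≤ 1) : K 1 ≤ K s :=
  hK.antitoneOn ⟨h0, h1⟩ ⟨zero_le_one, le_rfl⟩ h1

theorem nonneg (hK : IsKernel K) (s : ℝ) : 0 ≤ K s := by
  by_cases hs : s ∈ Set.Icc (0 : ℝ) 1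
  · exact hK.pos.le.trans (hK.one_le hs.1 hs.2)
  · exact (hK.support s hs).ge

theorem le_zero (hK : IsKernel K) (s : ℝ) : K s ≤ K 0 := by
  by_cases hs : s ∈ Set.Icc (0 : ℝ) 1
  · exact hK.antitoneOn ⟨le_rfl, zero_le_one⟩ hs hs.1
  · rw [hK.support s hs]; exact hK.nonneg 0

theorem zero_pos (hK : IsKernel K) : 0 < K 0 := hK.pos.trans_le (hK.le_zero 1)

theorem measurable (hK : IsKernel K) : Measurable K := by
  classical
  have h1 : K = (Set.Icc (0 : ℝ) 1).piecewise K 0 := by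
    ext s
    by_cases hs : s ∈ Set.Icc (0 : ℝ) 1
    · simp [Set.piecewise, hs]
    · simp [Set.piecewise, hs, hK.support s hs]
  rw [h1]
  exact hK.contDiffOn.continuousOn.measurable_piecewise continuousOn_const measurableSet_Icc

end IsKernel

/-! ### Kernel weights and their oscillation -/

section Weights

variable {E : Type*} [NormedAddCommGroup E]

/-- A bound, up to a factor, for the change of the kernel weights with bandwidth `b` when the centre
`z` moves by at most `2 * b * l`: of order `l` near `z`, because the kernel is Lipschitz on `[0, 1]`,
and of order one in the annulus where the kernel may jump. The normalization makes it at most one. -/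
noncomputable def oscWeight (b l : ℝ) (z x : E) : ℝ :=
  (l * (Metric.closedBall z (2 * b)).indicator (fun _ => (1 : ℝ)) x +
    (Metric.closedBall z (b + 2 * b * l) \ Metric.closedBall z (b - 2 * b * l)).indicator
      (fun _ => (1 : ℝ)) x) / 2

theorem oscWeight_nonneg {b l : ℝ} (hl : 0 ≤ l) (z x : E) : 0 ≤ oscWeight b l z x := by
  unfold oscWeight
  have h1 : ∀ s : Set E, 0 ≤ s.indicator (fun _ => (1 : ℝ)) x := fun s =>
    Set.indicator_nonneg (fun _ _ => zero_le_one) x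
  have := h1 (Metric.closedBall z (2 * b))
  have := h1 (Metric.closedBall z (b + 2 * b * l) \ Metric.closedBall z (b - 2 * b * l))
  positivity

theorem oscWeight_le_one {b l : ℝ} (hl : 0 ≤ l) (hl1 : l ≤ 1) (z x : E) :
    oscWeight b l z x ≤ 1 := by
  unfold oscWeight
  have h1 : ∀ s : Set E, s.indicator (fun _ => (1 : ℝ)) x ≤ 1 := fun s =>
    Set.indicator_le' (fun _ _ => le_rfl) (fun _ _ => zero_le_one) x
  have h2 := h1 (Metric.closedBall z (2 * b))
  have := h1 (Metric.closedBall z (b + 2 * b * l) \ Metric.closedBall z (b - 2 * b * l))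
  have h3 := mul_le_mul_of_nonneg_left h2 hl
  linarith

theorem measurable_oscWeight [MeasurableSpace E] [BorelSpace E] (b l : ℝ) (z : E) :
    Measurable (oscWeight b l z) := by
  unfold oscWeight
  have h1 : Measurable ((Metric.closedBall z (2 * b)).indicator fun _ => (1 : ℝ)) :=
    measurable_const.indicator measurableSet_closedBall
  have h2 : Measurable ((Metric.closedBall z (b + 2 * b * l) \
      Metric.closedBall z (b - 2 * b * l)).indicator fun _ => (1 : ℝ)) :=
    measurable_const.indicator (measurableSet_closedBall.diff measurableSet_closedBall)
  fun_prop

theorem half_mul_le_oscWeight {b l : ℝ} {z x : E} (hx : dist x z ≤ 2 * b) :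
    l / 2 ≤ oscWeight b l z x := by
  unfold oscWeight
  have h1 : 0 ≤ (Metric.closedBall z (b + 2 * b * l) \ Metric.closedBall z (b - 2 * b * l)).indicator
      (fun _ => (1 : ℝ)) x := Set.indicator_nonneg (fun _ _ => zero_le_one) x
  rw [Set.indicator_of_mem (Metric.mem_closedBall.2 hx)]
  linarith

theorem half_le_oscWeight {b l : ℝ} (hl : 0 ≤ l) {z x : E} (hx : dist x z ≤ b + 2 * b * l)
    (hx' : b - 2 * b * l < dist x z) : 1 / 2 ≤ oscWeight b l z x := by
  unfold oscWeight
  have h1 : 0 ≤ (Metric.closedBall z (2 * b)).indicator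
      (fun _ => (1 : ℝ)) x := Set.indicator_nonneg (fun _ _ => zero_le_one) x
  have h2 : x ∈ Metric.closedBall z (b + 2 * b * l) \ Metric.closedBall z (b - 2 * b * l) :=
    ⟨hx, fun h => absurd (Metric.mem_closedBall.1 h) (not_le.2 hx')⟩
  rw [Set.indicator_of_mem h2]
  have := mul_nonneg hl h1
  linarith

theorem IsKernel.weight_le_mul_oscWeight {K : ℝ → ℝ} (hK : IsKernel K) {b l : ℝ} (hb : 0 < b)
    (hl : 0 < l) (z x : E) : K (b⁻¹ * ‖x - z‖) ≤ 2 * K 0 * l⁻¹ * oscWeight b l z x := by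
  have hK0 := hK.zero_pos
  by_cases hx : ‖x - z‖ ≤ b
  · have h1 := half_mul_le_oscWeight (l := l) (z := z) (x := x) (b := b)
      (by rw [dist_eq_norm]; linarith)
    calc K (b⁻¹ * ‖x - z‖) ≤ K 0 := hK.le_zero _
      _ = 2 * K 0 * l⁻¹ * (l / 2) := by field_simp
      _ ≤ _ := by gcongr
  · rw [hK.support _ fun h => hx (by
      have h2 := h.2
      rwa [inv_mul_le_iff₀ hb, mul_one] at h2)]
    have := oscWeight_nonneg (b := b) hl.le z x
    positivity

theorem IsKernel.abs_weight_sub_le {K : ℝ → ℝ} (hK : IsKernel K) {M : ℝ≥0}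
    (hM : LipschitzOnWith M K (Set.Icc 0 1)) {b l : ℝ} (hb : 0 < b) (hl : 0 < l) {x z : E}
    (hxz : ‖x - z‖ ≤ 2 * b * l) (ξ : E) :
    |K (b⁻¹ * ‖ξ - x‖) - K (b⁻¹ * ‖ξ - z‖)| ≤ (4 * M + 2 * K 0) * oscWeight b l z ξ := by
  have hK0 := hK.zero_pos
  have hM0 := M.coe_nonneg
  have hW := oscWeight_nonneg (b := b) hl.le z ξ
  have hd : |‖ξ - x‖ - ‖ξ - z‖| ≤ 2 * b * l := by
    refine (abs_norm_sub_norm_le _ _).trans ?_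
    rw [sub_sub_sub_cancel_left, norm_sub_rev]
    exact hxz
  obtain ⟨hd1, hd2⟩ := abs_le.1 hd
  have hmem : ∀ y : E, b⁻¹ * ‖ξ - y‖ ∈ Set.Icc (0 : ℝ) 1 ↔ ‖ξ - y‖ ≤ b := fun y => by
    rw [Set.mem_Icc, inv_mul_le_iff₀ hb, mul_one]
    exact ⟨fun h => h.2, fun h => ⟨by positivity, h⟩⟩
  by_cases h1 : ‖ξ - x‖ ≤ b <;> by_cases h2 : ‖ξ - z‖ ≤ b
  · have h3 := hM.dist_le_mul _ ((hmem x).2 h1) _ ((hmem z).2 h2)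
    rw [Real.dist_eq, Real.dist_eq, ← mul_sub, abs_mul, abs_of_pos (inv_pos.2 hb)] at h3
    have h4 := half_mul_le_oscWeight (l := l) (z := z) (x := ξ) (b := b)
      (by rw [dist_eq_norm]; linarith)
    calc _ ≤ M * (b⁻¹ * |‖ξ - x‖ - ‖ξ - z‖|) := h3
      _ ≤ M * (b⁻¹ * (2 * b * l)) := by gcongr
      _ = 4 * M * (l / 2) := by field_simp; ring
      _ ≤ 4 * M * oscWeight b l z ξ := by gcongr
      _ ≤ _ := by nlinarith
  · have h4 := half_le_oscWeight hl.le (z := z) (x := ξ) (b := b)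
      (by rw [dist_eq_norm]; linarith) (by rw [dist_eq_norm]; nlinarith)
    rw [hK.support _ fun h => h2 ((hmem z).1 h), sub_zero, abs_of_nonneg (hK.nonneg _)]
    have := hK.le_zero (b⁻¹ * ‖ξ - x‖)
    nlinarith
  · have h4 := half_le_oscWeight hl.le (z := z) (x := ξ) (b := b)
      (by rw [dist_eq_norm]; nlinarith) (by rw [dist_eq_norm]; linarith)
    rw [hK.support _ fun h => h1 ((hmem x).1 h), zero_sub, abs_neg, abs_of_nonneg (hK.nonneg _)]
    have := hK.le_zero (b⁻¹ * ‖ξ - z‖)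
    nlinarith
  · rw [hK.support _ fun h => h1 ((hmem x).1 h), hK.support _ fun h => h2 ((hmem z).1 h), sub_zero,
      abs_zero]
    positivity

/-- The error of a kernel estimate at `x` in terms of quantities at a neighbouring point `z`: the bias is
at most the bandwidth `b`, and the stochastic part is a quotient of noise and occupation counts. -/
theorem IsKernel.norm_estimate_sub_le [NormedSpace ℝ E] {K : ℝ → ℝ} (hK : IsKernel K) {M : ℝ≥0}
    (hM : LipschitzOnWith M K (Set.Icc 0 1)) {b l : ℝ} (hb : 0 < b) (hl : 0 < l) (hl4 : l ≤ 1 / 4)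
    {x z : E} (hxz : ‖x - z‖ ≤ 2 * b * l) {n : ℕ} {ξ ψ η : ℕ → E} {ψx : E}
    (hψ : ∀ k, ‖ψ k - ψx‖ ≤ ‖ξ k - x‖) {c s A A' : ℝ} (hc : 0 < c) (hs : 0 < s)
    (hcount : c * s ≤ ∑ k ∈ Finset.range n,
      (Metric.closedBall z (b / 2)).indicator (fun _ => (1 : ℝ)) (ξ k))
    (hnoise : ‖∑ k ∈ Finset.range n, K (b⁻¹ * ‖ξ k - z‖) • η k‖ ≤ A * l * s)
    (hosc : ∑ k ∈ Finset.range n, oscWeight b l z (ξ k) * ‖η k‖ ≤ A' * l * s) :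
    ‖(∑ k ∈ Finset.range n, K (b⁻¹ * ‖ξ k - x‖))⁻¹ •
        ∑ k ∈ Finset.range n, K (b⁻¹ * ‖ξ k - x‖) • (ψ k + η k) - ψx‖
      ≤ b + (A + (4 * M + 2 * K 0) * A') / (K 1 * c) * l := by
  have hK1 := hK.pos
  set w : ℕ → ℝ := fun k => K (b⁻¹ * ‖ξ k - x‖) with hw
  set Q : ℝ := ∑ k ∈ Finset.range n, w k with hQ
  have hw0 : ∀ k, 0 ≤ w k := fun k => hK.nonneg _
  have hQle : K 1 * c * s ≤ Q := by
    calc K 1 * c * s = K 1 * (c * s) := by ring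
      _ ≤ K 1 * ∑ k ∈ Finset.range n,
          (Metric.closedBall z (b / 2)).indicator (fun _ => (1 : ℝ)) (ξ k) := by gcongr
      _ ≤ Q := by
        rw [Finset.mul_sum]
        refine Finset.sum_le_sum fun k _ => ?_
        by_cases hk : ξ k ∈ Metric.closedBall z (b / 2)
        · rw [Set.indicator_of_mem hk, mul_one]
          rw [Metric.mem_closedBall, dist_eq_norm] at hk
          refine hK.one_le (by positivity) ?_
          rw [inv_mul_le_iff₀ hb, mul_one]
          have h1 : ‖ξ k - x‖ ≤ ‖ξ k - z‖ + ‖x - z‖ := by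
            rw [← norm_sub_rev z x]
            exact norm_sub_le_norm_sub_add_norm_sub _ _ _
          nlinarith
        · rw [Set.indicator_of_notMem hk, mul_zero]
          exact hw0 k
  have hQ0 : 0 < Q := lt_of_lt_of_le (by positivity) hQle
  have hsplit : Q⁻¹ • ∑ k ∈ Finset.range n, w k • (ψ k + η k) - ψx =
      Q⁻¹ • ∑ k ∈ Finset.range n, w k • (ψ k - ψx) + Q⁻¹ • ∑ k ∈ Finset.range n, w k • η k := by
    have h1 : ψx = Q⁻¹ • ∑ k ∈ Finset.range n, w k • ψx := by
      rw [← Finset.sum_smul, smul_smul, inv_mul_cancel₀ hQ0.ne', one_smul]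
    conv_lhs => rw [h1]
    rw [← smul_sub, ← smul_add, ← Finset.sum_sub_distrib, ← Finset.sum_add_distrib]
    congr 1
    refine Finset.sum_congr rfl fun k _ => ?_
    rw [← smul_sub, ← smul_add]
    congr 1
    abel
  have hbias : ‖Q⁻¹ • ∑ k ∈ Finset.range n, w k • (ψ k - ψx)‖ ≤ b := by
    rw [norm_smul, norm_inv, Real.norm_of_nonneg hQ0.le, inv_mul_le_iff₀ hQ0, hQ, Finset.sum_mul]
    refine (norm_sum_le _ _).trans (Finset.sum_le_sum fun k _ => ?_)
    rw [norm_smul, Real.norm_of_nonneg (hw0 k)]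
    by_cases hk : ‖ξ k - x‖ ≤ b
    · exact mul_le_mul_of_nonneg_left ((hψ k).trans hk) (hw0 k)
    · have : w k = 0 := hK.support _ fun h => hk (by
        have h2 := h.2
        rwa [inv_mul_le_iff₀ hb, mul_one] at h2)
      rw [this, zero_mul, zero_mul]
  have hN : ‖∑ k ∈ Finset.range n, w k • η k‖ ≤ (A + (4 * M + 2 * K 0) * A') * (l * s) := by
    have e : ∑ k ∈ Finset.range n, w k • η k = ∑ k ∈ Finset.range n, K (b⁻¹ * ‖ξ k - z‖) • η k +
        ∑ k ∈ Finset.range n, (w k - K (b⁻¹ * ‖ξ k - z‖)) • η k := by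
      rw [← Finset.sum_add_distrib]
      refine Finset.sum_congr rfl fun k _ => ?_
      rw [← add_smul, add_sub_cancel]
    rw [e]
    refine (norm_add_le _ _).trans ?_
    have h2 : ‖∑ k ∈ Finset.range n, (w k - K (b⁻¹ * ‖ξ k - z‖)) • η k‖ ≤
        (4 * M + 2 * K 0) * (A' * l * s) := by
      refine (norm_sum_le _ _).trans ?_
      have hpos : 0 ≤ 4 * (M : ℝ) + 2 * K 0 := by
        have := hK.zero_pos
        have := M.coe_nonneg
        positivity
      refine le_trans ?_ (mul_le_mul_of_nonneg_left hosc hpos)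
      rw [Finset.mul_sum]
      refine Finset.sum_le_sum fun k _ => ?_
      rw [norm_smul, Real.norm_eq_abs, ← mul_assoc]
      exact mul_le_mul_of_nonneg_right (hK.abs_weight_sub_le hM hb hl hxz (ξ k)) (norm_nonneg _)
    linarith
  rw [hsplit]
  refine (norm_add_le _ _).trans (add_le_add hbias ?_)
  rw [norm_smul, norm_inv, Real.norm_of_nonneg hQ0.le, inv_mul_le_iff₀ hQ0]
  have hAA : 0 ≤ (A + (4 * M + 2 * K 0) * A') / (K 1 * c) * l := by
    have h3 : 0 ≤ A + (4 * M + 2 * K 0) * A' := by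
      have h4 := (norm_nonneg _).trans hN
      exact nonneg_of_mul_nonneg_left h4 (by positivity)
    positivity
  calc _ ≤ (A + (4 * M + 2 * K 0) * A') * (l * s) := hN
    _ = K 1 * c * s * ((A + (4 * M + 2 * K 0) * A') / (K 1 * c) * l) := by field_simp
    _ ≤ _ := mul_le_mul_of_nonneg_right hQle hAA

end Weights

/-! ### Deviations at a fixed point -/

section FixedPoint

variable {E : Type*} [NormedAddCommGroup E] [InnerProductSpace ℝ E] [CompleteSpace E]
  [MeasurableSpace E] [BorelSpace E] [SecondCountableTopology E] {Ω : Type*} [MeasurableSpace Ω]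
  {μ : Measure Ω} [IsProbabilityMeasure μ] {Ψ : E → E} {L : ℝ≥0} {X ε : ℤ → Ω → E}

/-- The sample `X 1, …, X n` is well spread around `z` with respect to the bandwidth `b`: many
observations close to `z`, small noise, and small noise in the oscillation of the weights. -/
def GoodSample (X ε : ℤ → Ω → E) (K : ℝ → ℝ) (b l s c A A' : ℝ) (n : ℕ) (z : E) (ω : Ω) : Prop :=
  c * s ≤ ∑ k ∈ Finset.range n,
      (Metric.closedBall z (b / 2)).indicator (fun _ => (1 : ℝ)) (X (k + 1) ω) ∧
  ‖∑ k ∈ Finset.range n, K (b⁻¹ * ‖X (k + 1) ω - z‖) • ε (k + 1 + 1) ω‖ ≤ A * l * s ∧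
  ∑ k ∈ Finset.range n, oscWeight b l z (X (k + 1) ω) * ‖ε (k + 1 + 1) ω‖ ≤ A' * l * s

omit [InnerProductSpace ℝ E] [CompleteSpace E] [SecondCountableTopology E] in
theorem IsContractiveChain.integral_oscWeight_le (h : IsContractiveChain μ Ψ L X ε) {b l q : ℝ}
    (hl : 0 ≤ l) (z x : E)
    (hball : (μ.map (ε 0)).real {y | Ψ x + y ∈ Metric.closedBall z (2 * b)} ≤ q)
    (hann : (μ.map (ε 0)).real {y | Ψ x + y ∈
      Metric.closedBall z (b + 2 * b * l) \ Metric.closedBall z (b - 2 * b * l)} ≤ l * q) :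
    ∫ y, oscWeight b l z (Ψ x + y) ∂(μ.map (ε 0)) ≤ l * q := by
  have := h.isProbabilityMeasure_law
  have key : ∀ s : Set E, MeasurableSet s →
      Integrable (fun y => s.indicator (fun _ => (1 : ℝ)) (Ψ x + y)) (μ.map (ε 0)) ∧
      ∫ y, s.indicator (fun _ => (1 : ℝ)) (Ψ x + y) ∂(μ.map (ε 0)) =
        (μ.map (ε 0)).real {y | Ψ x + y ∈ s} := by
    intro s hs
    have hm : MeasurableSet {y | Ψ x + y ∈ s} := by
      have : Measurable fun y => Ψ x + y := by fun_prop
      exact this hs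
    refine ⟨(integrable_const (1 : ℝ)).indicator hm, ?_⟩
    have := integral_indicator_const (μ := μ.map (ε 0)) (1 : ℝ) hm
    rw [smul_eq_mul, mul_one] at this
    exact this
  have h1 := key (Metric.closedBall z (2 * b)) measurableSet_closedBall
  have h2 := key (Metric.closedBall z (b + 2 * b * l) \ Metric.closedBall z (b - 2 * b * l))
    (measurableSet_closedBall.diff measurableSet_closedBall)
  unfold oscWeight
  rw [integral_div, integral_add (h1.1.const_mul l) h2.1, integral_const_mul, h1.2, h2.2]
  have := mul_le_mul_of_nonneg_left hball hl
  linarith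

/-- Outside an event of probability `5 exp (-c l² n φ)`, either the reference set `B` has been visited
too rarely or the sample is well spread around `z`. -/
theorem IsContractiveChain.measure_not_goodSample_le (h : IsContractiveChain μ Ψ L X ε) {θ₀ V : ℝ}
    (hB : HasBernsteinBound (μ.map (ε 0)) θ₀ V)
    (hint : Integrable (fun y : E => y) (μ.map (ε 0)))
    (hcent : ∫ y, y ∂(μ.map (ε 0)) = 0) {K : ℝ → ℝ} (hK : IsKernel K) {b l p C c₀ c₁ : ℝ}
    (hb : 0 < b) (hl : 0 < l) (hl1 : l ≤ 1) (hp : 0 < p) (hC : 0 ≤ C) (hc₀ : 0 < c₀)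
    (hc₁ : 0 < c₁) (n : ℕ) (z : E) {B : Set E} (hBm : MeasurableSet B)
    (hball : ∀ t, ∀ᵐ ω ∂μ,
      (μ.map (ε 0)).real {y | Ψ (X t ω) + y ∈ Metric.closedBall z (2 * b)} ≤ C * p)
    (hann : ∀ t, ∀ᵐ ω ∂μ, (μ.map (ε 0)).real {y | Ψ (X t ω) + y ∈
      Metric.closedBall z (b + 2 * b * l) \ Metric.closedBall z (b - 2 * b * l)} ≤ l * (C * p))
    (hlow : ∀ t, ∀ᵐ ω ∂μ, X t ω ∈ B →
      c₀ * p ≤ (μ.map (ε 0)).real {y | Ψ (X t ω) + y ∈ Metric.closedBall z (b / 2)}) :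
    μ {ω | c₁ * n ≤ ∑ k ∈ Finset.range n, B.indicator (fun _ => (1 : ℝ)) (X k ω) ∧
        ¬ GoodSample X ε K b l (n * p) (c₀ * c₁ / 4)
          (K 0 / θ₀ * (1 + 2 * V * θ₀ ^ 2 * (1 + 2 * C))) (θ₀⁻¹ + V * (1 + 2 * C)) n z ω}
      ≤ 5 * ENNReal.ofReal (Real.exp (-(min 1 (c₀ * c₁ / 4) * (l ^ 2 * (n * p))))) := by
  have hθ := hB.pos
  have hV := hB.nonneg
  have hK0 := hK.zero_pos
  set s : ℝ := n * p with hs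
  have hs0 : 0 ≤ s := by positivity
  set e := ENNReal.ofReal (Real.exp (-(min 1 (c₀ * c₁ / 4) * (l ^ 2 * s)))) with he
  have hle : ∀ v : ℝ, min 1 (c₀ * c₁ / 4) * (l ^ 2 * s) ≤ v →
      ENNReal.ofReal (Real.exp (-v)) ≤ e := fun v hv =>
    ENNReal.ofReal_le_ofReal (Real.exp_le_exp.2 (neg_le_neg hv))
  have hm1 : min 1 (c₀ * c₁ / 4) ≤ 1 := min_le_left _ _
  have hm2 : min 1 (c₀ * c₁ / 4) ≤ c₀ * c₁ / 4 := min_le_right _ _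
  have hm0 : 0 ≤ min 1 (c₀ * c₁ / 4) := le_min zero_le_one (by positivity)
  have hl2 : l ^ 2 ≤ l := by nlinarith
  have hl21 : l ^ 2 ≤ 1 := hl2.trans hl1
  have hms : min 1 (c₀ * c₁ / 4) * (l ^ 2 * s) ≤ l ^ 2 * s :=
    mul_le_of_le_one_left (by positivity) hm1
  have hls : l ^ 2 * s ≤ l * s := mul_le_mul_of_nonneg_right hl2 hs0
  -- the mean of the oscillation weights
  have hW : ∀ t, ∀ᵐ ω ∂μ, ∫ y, oscWeight b l z (Ψ (X t ω) + y) ∂(μ.map (ε 0)) ≤ l * (C * p) := by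
    intro t
    filter_upwards [hball t, hann t] with ω h1 h2
    exact h.integral_oscWeight_le hl.le z (X t ω) h1 h2
  set Wsum : Ω → ℝ := fun ω => ∑ k ∈ Finset.range n, oscWeight b l z (X (k + 1) ω) with hWsum
  have hE1 : μ {ω | (1 + 2 * C) * (l * s) ≤ Wsum ω} ≤ e := by
    have h1 := h.measure_sum_weight_ge (measurable_oscWeight b l z) (oscWeight_nonneg hl.le z)
      (oscWeight_le_one hl.le hl1 z) hW 0 n (l * s)
    simp only [zero_add] at h1
    have e1 : l * s + 2 * n * (l * (C * p)) = (1 + 2 * C) * (l * s) := by rw [hs]; ring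
    rw [e1] at h1
    exact h1.trans (hle _ (hms.trans hls))
  have hE2 : μ {ω | (θ₀⁻¹ + V * (1 + 2 * C)) * l * s ≤ ∑ k ∈ Finset.range n,
      oscWeight b l z (X (k + 1) ω) * ‖ε (k + 1 + 1) ω‖ ∧ Wsum ω ≤ (1 + 2 * C) * (l * s)} ≤ e := by
    have h1 := h.measure_sum_weight_norm_ge hB (measurable_oscWeight b l z)
      (oscWeight_nonneg hl.le z) (oscWeight_le_one hl.le hl1 z) 1 n ((1 + 2 * C) * (l * s)) (l * s)
    simp only [add_comm (1 : ℤ)] at h1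
    have e1 : θ₀⁻¹ * (l * s) + V * ((1 + 2 * C) * (l * s)) =
        (θ₀⁻¹ + V * (1 + 2 * C)) * l * s := by ring
    rw [e1] at h1
    exact h1.trans (hle _ (hms.trans hls))
  have hE3 : μ {ω | K 0 / θ₀ * (1 + 2 * V * θ₀ ^ 2 * (1 + 2 * C)) * l * s ≤
      ‖∑ k ∈ Finset.range n, K (b⁻¹ * ‖X (k + 1) ω - z‖) • ε (k + 1 + 1) ω‖ ∧
      ∑ k ∈ Finset.range n, K (b⁻¹ * ‖X (k + 1) ω - z‖) ≤ 2 * K 0 * (1 + 2 * C) * s} ≤ 2 * e := by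
    have hKm := hK.measurable
    have hw : Measurable fun x : E => K (b⁻¹ * ‖x - z‖) := by fun_prop
    have h1 := h.measure_noise_le hB hint hcent hw (θ := l * θ₀ / K 0) (κ := K 0)
      (fun x => hK.nonneg _) (fun x => hK.le_zero _) (by positivity)
      (by rw [div_mul_cancel₀ _ hK0.ne']; nlinarith) 1 n
      (K 0 / θ₀ * (1 + 2 * V * θ₀ ^ 2 * (1 + 2 * C)) * l * s) (2 * K 0 * (1 + 2 * C) * s)
    simp only [add_comm (1 : ℤ)] at h1
    have e1 : V * (l * θ₀ / K 0) ^ 2 * K 0 * (2 * K 0 * (1 + 2 * C) * s) -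
        l * θ₀ / K 0 * (K 0 / θ₀ * (1 + 2 * V * θ₀ ^ 2 * (1 + 2 * C)) * l * s) = -(l ^ 2 * s) := by
      field_simp
      ring
    rw [e1, ENNReal.ofReal_mul (by norm_num), ENNReal.ofReal_ofNat] at h1
    exact h1.trans (mul_le_mul_right (hle _ hms) _)
  have hE4 : μ {ω | ∑ k ∈ Finset.range n,
      (Metric.closedBall z (b / 2)).indicator (fun _ => (1 : ℝ)) (X (k + 1) ω) ≤ c₀ * c₁ / 4 * s ∧
      c₁ * n ≤ ∑ k ∈ Finset.range n, B.indicator (fun _ => (1 : ℝ)) (X k ω)} ≤ e := by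
    have h1 := h.measure_visits_le measurableSet_closedBall hBm hlow 0 n (c₀ * c₁ / 4 * s)
      (c₀ * c₁ / 4 * s)
    simp only [zero_add] at h1
    refine (measure_mono fun ω hω => ?_).trans (h1.trans (hle _ ?_))
    · refine ⟨hω.1, ?_⟩
      have h2 := mul_le_mul_of_nonneg_left hω.2 (mul_pos hc₀ hp).le
      have e2 : 2 * (c₀ * c₁ / 4 * s + c₀ * c₁ / 4 * s) = c₀ * p * (c₁ * n) := by rw [hs]; ring
      rw [e2]
      exact h2
    · have : l ^ 2 * s ≤ s := mul_le_of_le_one_left hs0 hl21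
      have h5 : 0 ≤ l ^ 2 * s := by positivity
      nlinarith
  have hsum5 : e + (e + (2 * e + e)) = 5 * e := by ring
  rw [← hsum5]
  refine le_trans (measure_mono fun ω hω => ?_) ((measure_union_le _ _).trans (add_le_add hE1
    ((measure_union_le _ _).trans (add_le_add hE2
      ((measure_union_le _ _).trans (add_le_add hE3 hE4))))))
  obtain ⟨hv, hbad⟩ := hω
  by_contra hcon
  simp only [Set.mem_union, Set.mem_ofPred_eq, not_or, not_le, not_and] at hcon
  obtain ⟨g1, g2, g3, g4⟩ := hcon
  refine hbad ⟨?_, ?_, ?_⟩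
  · by_contra h6
    exact absurd hv (not_le.2 (g4 (not_le.1 h6).le))
  · by_contra h6
    refine absurd ?_ (not_le.2 (g3 (not_le.1 h6).le))
    calc ∑ k ∈ Finset.range n, K (b⁻¹ * ‖X (k + 1) ω - z‖)
        ≤ ∑ k ∈ Finset.range n, 2 * K 0 * l⁻¹ * oscWeight b l z (X (k + 1) ω) :=
          Finset.sum_le_sum fun k _ => hK.weight_le_mul_oscWeight hb hl z _
      _ = 2 * K 0 * l⁻¹ * Wsum ω := by rw [← Finset.mul_sum]
      _ ≤ 2 * K 0 * l⁻¹ * ((1 + 2 * C) * (l * s)) := by gcongr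
      _ = _ := by field_simp
  · by_contra h6
    exact absurd g1.le (not_le.2 (g2 (not_le.1 h6).le))

end FixedPoint

/-! ### Small ball probabilities -/

section ShiftedBalls

variable {E : Type*} [NormedAddCommGroup E] [MeasurableSpace E] [BorelSpace E] {Ω : Type*}
  [MeasurableSpace Ω] {μ : Measure Ω} {Z : Ω → E}

theorem measurableSet_add_mem_closedBall (z a : E) (u : ℝ) :
    MeasurableSet {y | a + y ∈ Metric.closedBall z u} := by
  have : Continuous fun y : E => a + y := by fun_prop
  exact this.measurable measurableSet_closedBall

theorem map_real_closedBall (hZ : Measurable Z) (z a : E) (u : ℝ) :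
    (μ.map Z).real {y | a + y ∈ Metric.closedBall z u} = μ.real {ω | ‖Z ω - (z - a)‖ ≤ u} := by
  rw [map_measureReal_apply hZ (measurableSet_add_mem_closedBall z a u)]
  congr 1
  ext ω
  simp only [Set.mem_preimage, Set.mem_ofPred_eq, Metric.mem_closedBall, dist_eq_norm]
  rw [show a + Z ω - z = Z ω - (z - a) by abel]

theorem map_real_closedBall_diff [IsProbabilityMeasure μ] (hZ : Measurable Z) (z a : E) {u u' : ℝ}
    (h : u' ≤ u) :
    (μ.map Z).real {y | a + y ∈ Metric.closedBall z u \ Metric.closedBall z u'} =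
      μ.real {ω | ‖Z ω - (z - a)‖ ≤ u} - μ.real {ω | ‖Z ω - (z - a)‖ ≤ u'} := by
  have := Measure.isProbabilityMeasure_map hZ.aemeasurable (μ := μ)
  have hsub : {y | a + y ∈ Metric.closedBall z u'} ⊆ {y | a + y ∈ Metric.closedBall z u} :=
    fun y hy => Metric.closedBall_subset_closedBall h hy
  rw [← map_real_closedBall hZ, ← map_real_closedBall hZ,
    ← measureReal_sdiff hsub (measurableSet_add_mem_closedBall z a u')]
  rfl

end ShiftedBalls

section SmallBall

variable {d : ℕ} {D : Set (Euc d)} {ν : Measure (Euc d)} {Ω : Type*} [MeasurableSpace Ω]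
  {μ : Measure Ω} {S : Submodule ℝ (L2Fun ν)} {Z : Ω → L2Fun ν} {α : ℝ}
  {x₀ : L2Fun ν} {f : L2Fun ν → ℝ} {φ : ℝ → ℝ}

theorem smallBall_nonneg (y : L2Fun ν) (u : ℝ) : 0 ≤ smallBall μ Z y u := measureReal_nonneg

theorem smallBall_eq_map (hZ : Measurable Z) (z a : L2Fun ν) (u : ℝ) :
    (μ.map Z).real {y | a + y ∈ Metric.closedBall z u} = smallBall μ Z (z - a) u :=
  map_real_closedBall hZ z a u

variable [IsProbabilityMeasure μ]

theorem smallBall_mono (y : L2Fun ν) {u u' : ℝ} (h : u ≤ u') :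
    smallBall μ Z y u ≤ smallBall μ Z y u' :=
  measureReal_mono fun _ hω => le_trans hω h

theorem smallBall_annulus_eq_map (hZ : Measurable Z) (z a : L2Fun ν) {u u' : ℝ} (h : u' ≤ u) :
    (μ.map Z).real {y | a + y ∈ Metric.closedBall z u \ Metric.closedBall z u'} =
      smallBall μ Z (z - a) u - smallBall μ Z (z - a) u' :=
  map_real_closedBall_diff hZ z a h

namespace SmallBallCond

theorem exists_doubling (hsb : SmallBallCond D μ S Z α x₀ f φ) :
    ∃ C > 0, ∀ᶠ u in 𝓝[>] (0 : ℝ), ∀ y ∈ S, smallBall μ Z y (2 * u) ≤ C * smallBall μ Z y u := by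
  obtain ⟨L, hL⟩ := hsb.annulus
  refine ⟨1 + |L|, by positivity, ?_⟩
  filter_upwards [hL, self_mem_nhdsWithin] with u hu hu0 y hy
  have hu0' : (0 : ℝ) < u := hu0
  have h1 := hu u hu0' le_rfl y hy
  rw [div_self hu0'.ne', mul_one, ← two_mul, sub_self] at h1
  have h2 : smallBall μ Z y 0 ≤ smallBall μ Z y u := smallBall_mono y hu0'.le
  have h3 : L * smallBall μ Z y u ≤ |L| * smallBall μ Z y u :=
    mul_le_mul_of_nonneg_right (le_abs_self L) (smallBall_nonneg y u)
  linarith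

omit [IsProbabilityMeasure μ] in
/-- Small ball probabilities at the reference point are of order at most `φ`. -/
theorem exists_reference_le (hsb : SmallBallCond D μ S Z α x₀ f φ) (hx₀ : x₀ ∈ S)
    (hS : ∀ x ∈ S, ∃ r : ℝ, x ∈ lipBall D ν r) :
    ∃ C > 0, ∀ᶠ u in 𝓝[>] (0 : ℝ), smallBall μ Z x₀ u ≤ C * φ u := by
  obtain ⟨r, hr⟩ := hS x₀ hx₀
  refine ⟨|f x₀| + 1, by positivity, ?_⟩
  filter_upwards [hsb.expansion r 1 one_pos, hsb.φ_pos] with u hu hφ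
  have h1 := (abs_le.1 (hu x₀ ⟨hr, hx₀⟩)).2
  unfold smallBallRem at h1
  have h2 : f x₀ * φ u ≤ |f x₀| * φ u := mul_le_mul_of_nonneg_right (le_abs_self _) hφ.le
  linarith

/-- All small ball probabilities are of order at most `φ`: they are dominated by those at a fixed point
`z₀`, next to which there are points of `S`, and these are compared with the reference point. -/
theorem exists_le_mul (hsb : SmallBallCond D μ S Z α x₀ f φ) (hα : 0 < α) (hx₀ : x₀ ∈ S)
    (hS : ∀ x ∈ S, ∃ r : ℝ, x ∈ lipBall D ν r) (hZS : ∀ ω, Z ω ∈ S) :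
    ∃ C > 0, ∀ᶠ u in 𝓝[>] (0 : ℝ), ∀ y, smallBall μ Z y u ≤ C * φ u := by
  obtain ⟨C₁, hC₁, h₁⟩ := hsb.exists_doubling
  obtain ⟨C₂, hC₂, h₂⟩ := hsb.exists_reference_le hx₀ hS
  obtain ⟨z₀, h₃⟩ := hsb.maximal
  obtain ⟨C₄, h₄⟩ := hsb.holder
  set R : ℝ := (‖z₀ - x₀‖ + 1) ^ α with hR
  have hR0 : 0 ≤ R := by positivity
  refine ⟨C₁ * (1 + |C₄| * R) * C₂, by positivity, ?_⟩
  filter_upwards [h₁, h₂, h₃, h₄, hsb.pos, hsb.φ_pos, self_mem_nhdsWithin,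
    Ioo_mem_nhdsGT (zero_lt_one' ℝ)] with u g₁ g₂ g₃ g₄ gpos gφ gu gu1 y
  refine (g₃ y).trans ?_
  by_cases hz : smallBall μ Z z₀ u = 0
  · rw [hz]; positivity
  obtain ⟨ω, hω⟩ : {ω | ‖Z ω - z₀‖ ≤ u}.Nonempty := by
    by_contra hne
    rw [Set.not_nonempty_iff_eq_empty] at hne
    exact hz (by unfold smallBall; rw [hne]; simp)
  have hω' : ‖Z ω - z₀‖ ≤ u := hω
  have e1 : smallBall μ Z z₀ u ≤ smallBall μ Z (Z ω) (2 * u) := by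
    refine measureReal_mono fun ω' hω'' => ?_
    have h5 : ‖Z ω' - z₀‖ ≤ u := hω''
    change ‖Z ω' - Z ω‖ ≤ 2 * u
    have h6 := norm_sub_le_norm_sub_add_norm_sub (Z ω') z₀ (Z ω)
    rw [norm_sub_rev z₀] at h6
    linarith
  have e2 := g₁ (Z ω) (hZS ω)
  have e3 : smallBall μ Z (Z ω) u ≤ (1 + |C₄| * R) * smallBall μ Z x₀ u := by
    have h5 := (abs_le.1 (g₄ (Z ω) (hZS ω) x₀ hx₀)).2
    have h6 : ‖Z ω - x₀‖ ^ α ≤ R := by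
      refine Real.rpow_le_rpow (norm_nonneg _) ?_ hα.le
      have := norm_sub_le_norm_sub_add_norm_sub (Z ω) z₀ x₀
      linarith [gu1.2]
    have h7 : C₄ * ‖Z ω - x₀‖ ^ α ≤ |C₄| * R :=
      mul_le_mul (le_abs_self _) h6 (by positivity) (abs_nonneg _)
    rw [div_self gpos.ne'] at h5
    have h8 : smallBall μ Z (Z ω) u / smallBall μ Z x₀ u ≤ 1 + |C₄| * R := by linarith
    rwa [div_le_iff₀ gpos] at h8
  calc _ ≤ C₁ * ((1 + |C₄| * R) * (C₂ * φ u)) :=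
        e1.trans (e2.trans (mul_le_mul_of_nonneg_left (e3.trans
          (mul_le_mul_of_nonneg_left g₂ (by positivity))) hC₁.le))
    _ = _ := by ring

omit [IsProbabilityMeasure μ] in
/-- Where `f` is bounded below, the small ball probabilities are at least of order `φ`, on a
neighbourhood whose size depends on the lower bound only. -/
theorem exists_lower (hsb : SmallBallCond D μ S Z α x₀ f φ) (hα : 0 < α) (hx₀ : x₀ ∈ S)
    (hS : ∀ x ∈ S, ∃ r : ℝ, x ∈ lipBall D ν r) {c : ℝ} (hc : 0 < c) :
    ∃ δ > 0, ∀ y ∈ S, c ≤ f y → ∀ᶠ u in 𝓝[>] (0 : ℝ), ∀ y' ∈ S, ‖y' - y‖ ≤ δ →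
      c / 4 * φ u ≤ smallBall μ Z y' u := by
  obtain ⟨C₂, hC₂, h₂⟩ := hsb.exists_reference_le hx₀ hS
  obtain ⟨C₄, h₄⟩ := hsb.holder
  obtain ⟨δ, hδ, hδc⟩ : ∃ δ > 0, |C₄| * δ ^ α * C₂ ≤ c / 4 := by
    have h1 : Tendsto (fun t : ℝ => |C₄| * t ^ α * C₂) (𝓝[>] 0) (𝓝 (|C₄| * 0 ^ α * C₂)) := by
      have h2 : Continuous fun t : ℝ => |C₄| * t ^ α * C₂ := by
        have := Real.continuous_rpow_const (q := α) hα.le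
        fun_prop
      exact (h2.tendsto 0).mono_left nhdsWithin_le_nhds
    rw [Real.zero_rpow hα.ne', mul_zero, zero_mul] at h1
    obtain ⟨δ, h5, h6⟩ := ((h1.eventually_le_const (show 0 < c / 4 by positivity)).and
      self_mem_nhdsWithin).exists
    exact ⟨δ, h6, h5⟩
  refine ⟨δ, hδ, fun y hy hfy => ?_⟩
  obtain ⟨r, hr⟩ := hS y hy
  filter_upwards [h₂, h₄, hsb.pos, hsb.φ_pos, hsb.expansion r (c / 2) (by positivity)]
    with u g₂ g₄ gpos gφ gexp y' hy' hyy
  have e1 := (abs_le.1 (gexp y ⟨hr, hy⟩)).1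
  unfold smallBallRem at e1
  have e2 : c * φ u ≤ f y * φ u := mul_le_mul_of_nonneg_right hfy gφ.le
  have e3 := (abs_le.1 (g₄ y' hy' y hy)).1
  have e4 : ‖y' - y‖ ^ α ≤ δ ^ α := Real.rpow_le_rpow (norm_nonneg _) hyy hα.le
  have e5 : C₄ * ‖y' - y‖ ^ α ≤ |C₄| * δ ^ α :=
    mul_le_mul (le_abs_self _) e4 (by positivity) (abs_nonneg _)
  rw [← sub_div] at e3
  have e6 : -(|C₄| * δ ^ α) ≤ (smallBall μ Z y' u - smallBall μ Z y u) / smallBall μ Z x₀ u := by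
    linarith
  rw [le_div_iff₀ gpos] at e6
  have e7 : |C₄| * δ ^ α * smallBall μ Z x₀ u ≤ c / 4 * φ u := by
    calc _ ≤ |C₄| * δ ^ α * (C₂ * φ u) := by gcongr
      _ = |C₄| * δ ^ α * C₂ * φ u := by ring
      _ ≤ _ := by gcongr
  linarith

end SmallBallCond

end SmallBall

/-! ### Nets and rates -/

theorem exists_net_card_le_coverNum {d : ℕ} {ν : Measure (Euc d)} {U : Set (L2Fun ν)}
    (hU : TotallyBounded U) {η : ℝ} (hη : 0 < η) :
    ∃ T : Finset (L2Fun ν), (T : Set (L2Fun ν)) ⊆ U ∧ T.card ≤ coverNum U η ∧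
      ∀ x ∈ U, ∃ z ∈ T, ‖x - z‖ ≤ 2 * η := by
  have hη' : (0 : ℝ≥0) < η.toNNReal := Real.toNNReal_pos.2 hη
  have hfin : Metric.externalCoveringNumber η.toNNReal U ≠ ⊤ := by
    obtain ⟨t, ht, hcov⟩ := Metric.totallyBounded_iff.1 hU η hη
    have hc : Metric.IsCover η.toNNReal U t := by
      intro x hx
      obtain ⟨z, hz, hxz⟩ := Set.mem_iUnion₂.1 (hcov hx)
      refine ⟨z, hz, ?_⟩
      change edist x z ≤ _
      rw [edist_dist]
      exact ENNReal.ofReal_le_ofReal (Metric.mem_ball.1 hxz).le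
    exact ne_top_of_le_ne_top (Set.encard_ne_top_iff.2 ht) hc.externalCoveringNumber_le_encard
  have hle := Metric.coveringNumber_two_mul_le_externalCoveringNumber η.toNNReal U
  have hfin2 : Metric.coveringNumber (2 * η.toNNReal) U ≠ ⊤ := ne_top_of_le_ne_top hfin hle
  obtain ⟨t, htU, htfin, htcov, htcard⟩ := Metric.exists_set_encard_eq_coveringNumber hfin2
  refine ⟨htfin.toFinset, by simpa using htU, ?_, fun x hx => ?_⟩
  · unfold coverNum
    have h1 : ((htfin.toFinset.card : ℕ) : ℕ∞) ≤ Metric.externalCoveringNumber η.toNNReal U := by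
      rw [← Set.encard_coe_eq_coe_finsetCard, htfin.coe_toFinset, htcard]
      exact hle
    have h2 := ENat.toNat_le_toNat h1 hfin
    simpa using h2
  · obtain ⟨z, hz, hxz⟩ := htcov hx
    refine ⟨z, by simpa using hz, ?_⟩
    change edist x z ≤ _ at hxz
    rw [edist_nndist, ENNReal.coe_le_coe] at hxz
    have h3 : (nndist x z : ℝ) ≤ 2 * (η.toNNReal : ℝ) := by exact_mod_cast hxz
    rwa [coe_nndist, dist_eq_norm, Real.coe_toNNReal _ hη.le] at h3

/-- The logarithmic factors in the assumptions leave room for every constant in the exponent: after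
multiplication by the covering numbers `N n`, the exponential bounds are still summable. -/
theorem eventually_mul_exp_le {lam p : ℕ → ℝ} {N : ℕ → ℕ} (hp : ∀ᶠ n in atTop, 0 < p n)
    (lam_pos : ∀ n, 0 < lam n)
    (hsum : ∃ c > 0, Summable fun n : ℕ =>
      Real.exp (-(lam n ^ 2 * (c * (n * p n / Real.log n)))) * Real.log n)
    (hcov : Tendsto (fun n : ℕ => Real.log (N n) * Real.log n / (n * p n * lam n ^ 2)) atTop (𝓝 0))
    {c : ℝ} (hc : 0 < c) :
    ∀ᶠ n : ℕ in atTop, N n * Real.exp (-(c * (lam n ^ 2 * (n * p n)))) ≤ 1 / (n : ℝ) ^ 2 := by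
  obtain ⟨b, hb, hs⟩ := hsum
  have h1 := hs.tendsto_atTop_zero.eventually_lt_const (Real.exp_pos (-(b * (4 / c))))
  have hlog : ∀ᶠ n : ℕ in atTop, 1 ≤ Real.log n :=
    (Real.tendsto_log_atTop.comp tendsto_natCast_atTop_atTop).eventually_ge_atTop 1
  have h2 := hcov.eventually_lt_const (show 0 < c / 2 by positivity)
  filter_upwards [h1, h2, hlog, hp, eventually_gt_atTop 0] with n g1 g2 glog gp gn
  have hn : (0 : ℝ) < n := by exact_mod_cast gn
  have hl := lam_pos n
  have hlog0 : 0 < Real.log n := by linarith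
  set v : ℝ := lam n ^ 2 * (n * p n) with hv
  have hv0 : 0 < v := by positivity
  have e1 : 4 / c * Real.log n ≤ v := by
    have h3 : Real.exp (-(lam n ^ 2 * (b * (n * p n / Real.log n)))) < Real.exp (-(b * (4 / c))) :=
      lt_of_le_of_lt (le_mul_of_one_le_right (Real.exp_pos _).le glog) g1
    have h4 := Real.exp_lt_exp.1 h3
    have h5 : b * (4 / c) < b * (v / Real.log n) := by
      have : lam n ^ 2 * (b * (n * p n / Real.log n)) = b * (v / Real.log n) := by rw [hv]; ring
      linarith
    have h6 := lt_of_mul_lt_mul_left h5 hb.le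
    rw [lt_div_iff₀ hlog0] at h6
    exact h6.le
  have e2 : Real.log (N n) ≤ c / 2 * v := by
    rw [div_lt_iff₀ (by positivity)] at g2
    have h3 : Real.log (N n) ≤ Real.log (N n) * Real.log n :=
      le_mul_of_one_le_right (Real.log_natCast_nonneg _) glog
    have h4 : c / 2 * (n * p n * lam n ^ 2) = c / 2 * v := by rw [hv]; ring
    linarith
  have e3 : (N n : ℝ) ≤ Real.exp (c / 2 * v) := by
    rcases Nat.eq_zero_or_pos (N n) with h0 | h0
    · rw [h0, Nat.cast_zero]; positivity
    · rw [← Real.log_le_iff_le_exp (by exact_mod_cast h0)]; exact e2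
  calc _ ≤ Real.exp (c / 2 * v) * Real.exp (-(c * v)) := by gcongr
    _ = Real.exp (-(c / 2 * v)) := by rw [← Real.exp_add]; ring_nf
    _ ≤ Real.exp (-(2 * Real.log n)) := by
        refine Real.exp_le_exp.2 (neg_le_neg ?_)
        calc 2 * Real.log n = c / 2 * (4 / c * Real.log n) := by field_simp; ring
          _ ≤ _ := by gcongr
    _ = 1 / (n : ℝ) ^ 2 := by
        rw [Real.exp_neg, two_mul, Real.exp_add, Real.exp_log hn, one_div, sq]

/-! ### The functional autoregression as a contractive chain -/

theorem IsRegularDomain.secondCountableTopology {d : ℕ} {D : Set (Euc d)} {ν : Measure (Euc d)}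
    (hD : IsRegularDomain D ν) : SecondCountableTopology (L2Fun ν) := by
  have := hD.finite
  have : Fact ((2 : ℝ≥0∞) ≠ ∞) := ⟨by simp⟩
  exact MeasureTheory.Lp.SecondCountableTopology

section Main

variable {d : ℕ} {D : Set (Euc d)} {ν : Measure (Euc d)} {Ω : Type*} [MeasurableSpace Ω]
  {μ : Measure Ω} [IsProbabilityMeasure μ] {S : Submodule ℝ (L2Fun ν)} {Ψ : L2Fun ν → L2Fun ν}
  {X ε : ℤ → Ω → L2Fun ν}

omit [IsProbabilityMeasure μ] in
theorem IsFAR1.isContractiveChain (hX : IsFAR1 μ S Ψ X ε) {Ψ' : L2Fun ν → L2Fun ν} {L : ℝ≥0}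
    (hL : L < 1) (hlip : LipschitzWith L Ψ') (heq : ∀ x ∈ S, Ψ' x = Ψ x) :
    IsContractiveChain μ Ψ' L X ε where
  measurable_X := hX.measurable_X
  measurable_ε := hX.measurable_ε
  lt_one := hL
  lipschitz := hlip
  equation := by
    rw [ae_all_iff]
    intro t
    filter_upwards [hX.equation t] with ω hω
    rw [heq _ (hX.mem_X _ _)]
    exact hω
  identDistrib_ε := hX.identDistrib
  identDistrib_X t := by
    have := (hX.stationary t).comp (measurable_pi_apply (0 : ℤ))
    simpa only [Function.comp_def, zero_add] using! this
  indep := hX.causal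

omit [IsProbabilityMeasure μ] in
/-- The values of the regression operator along the chain lie in `𝒮`, being differences of observations
and innovations; this is not assumed for `Ψ` on all of `𝒮`. -/
theorem IsFAR1.ae_apply_mem (hX : IsFAR1 μ S Ψ X ε) {Ψ' : L2Fun ν → L2Fun ν}
    (heq : ∀ x ∈ S, Ψ' x = Ψ x) (t : ℤ) : ∀ᵐ ω ∂μ, Ψ' (X t ω) ∈ S := by
  filter_upwards [hX.equation (t + 1)] with ω hω
  rw [add_sub_cancel_right] at hω
  rw [heq _ (hX.mem_X _ _), show Ψ (X t ω) = X (t + 1) ω - ε (t + 1) ω by rw [hω]; abel]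
  exact S.sub_mem (hX.mem_X _ _) (hX.mem_ε _ _)

omit [MeasurableSpace Ω] in
theorem kernelEstimate_eq_sum_range (K : ℝ → ℝ) (X : ℤ → Ω → L2Fun ν) (n : ℕ) (b : ℝ)
    (x : L2Fun ν) (ω : Ω) :
    kernelEstimate K X n b x ω =
      (∑ k ∈ Finset.range n, K (b⁻¹ * ‖X (k + 1) ω - x‖))⁻¹ •
        ∑ k ∈ Finset.range n, K (b⁻¹ * ‖X (k + 1) ω - x‖) • X (k + 1 + 1) ω := by
  have h1 : ∀ {A : Type _} [AddCommMonoid A] (g : ℤ → A),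
      ∑ t ∈ Finset.Icc 1 n, g (t : ℤ) = ∑ k ∈ Finset.range n, g ((k : ℤ) + 1) := by
    intro A _ g
    rw [← Finset.Ico_add_one_right_eq_Icc, Finset.sum_Ico_eq_sum_range, Nat.add_sub_cancel]
    refine Finset.sum_congr rfl fun k _ => ?_
    push_cast
    rw [add_comm]
  unfold kernelEstimate kweight
  rw [h1 fun t => K (b⁻¹ * ‖X t ω - x‖), h1 fun t => K (b⁻¹ * ‖X t ω - x‖) • X (t + 1) ω]

/-- Finitely many constants may be replaced by the smallest one. -/
theorem exists_forall_finset_tsum_ne_top {ι : Type*} (T : Finset ι) {F : ι → ℝ → ℕ → ℝ≥0∞}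
    (hmono : ∀ i n, Monotone fun c => F i c n) (h : ∀ i ∈ T, ∃ c > 0, ∑' n, F i c n ≠ ⊤) :
    ∃ c > 0, ∑' n, ∑ i ∈ T, F i c n ≠ ⊤ := by
  classical
  induction T using Finset.induction_on with
  | empty => exact ⟨1, one_pos, by simp⟩
  | insert i T hi ih =>
    obtain ⟨c₁, hc₁, h₁⟩ := h i (Finset.mem_insert_self i T)
    obtain ⟨c₂, hc₂, h₂⟩ := ih fun j hj => h j (Finset.mem_insert_of_mem hj)
    refine ⟨min c₁ c₂, lt_min hc₁ hc₂, ?_⟩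
    simp only [Finset.sum_insert hi]
    refine tsum_add_ne_top (ne_top_of_le_ne_top h₁ (ENNReal.tsum_le_tsum fun n =>
      hmono i n (min_le_left _ _))) (ne_top_of_le_ne_top h₂ (ENNReal.tsum_le_tsum fun n =>
      Finset.sum_le_sum fun j _ => hmono j n (min_le_right _ _)))

/-- Reference points for a family `U` on which `f_X` is bounded below: around each of finitely many
points of `U` the conditional small ball probabilities are of order `φ` as soon as the chain is in a
certain ball, and that ball is visited linearly often. -/
theorem exists_reference_points [SecondCountableTopology (L2Fun ν)] {L : ℝ≥0}
    {Ψ' : L2Fun ν → L2Fun ν}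
    (hX : IsFAR1 μ S Ψ X ε) (h : IsContractiveChain μ Ψ' L X ε) (heq : ∀ x ∈ S, Ψ' x = Ψ x)
    {θ₀ V : ℝ} (hB : HasBernsteinBound (μ.map (ε 0)) θ₀ V)
    {α : ℝ} (hα : 0 < α) {x₀ : L2Fun ν} (hx₀ : x₀ ∈ S) {f : L2Fun ν → ℝ} {φ : ℝ → ℝ}
    (hsb : SmallBallCond D μ S (ε 0) α x₀ f φ) (hS : ∀ x ∈ S, ∃ r : ℝ, x ∈ lipBall D ν r)
    {U : Set (L2Fun ν)} (hUS : U ⊆ S) (hU : TotallyBounded U)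
    (hfX : ∃ c > 0, ∀ x ∈ U, c ≤ fX μ Ψ X f x) :
    ∃ (T : Finset (L2Fun ν)) (ξ : L2Fun ν → L2Fun ν) (δ c₀ : ℝ), 0 < c₀ ∧
      (∀ z ∈ T, VisitsLinearly μ X (Metric.ball (ξ z) δ)) ∧
      ∀ᶠ u in 𝓝[>] (0 : ℝ), ∀ x ∈ U, ∃ z ∈ T, ∀ x' ∈ Metric.ball (ξ z) δ, Ψ' x' ∈ S →
        c₀ * φ u ≤ smallBall μ (ε 0) (x - Ψ' x') (u / 2) := by
  obtain ⟨c, hc, hcU⟩ := hfX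
  obtain ⟨δ, hδ, hlow⟩ := hsb.exists_lower hα hx₀ hS (c := c / 2) (by positivity)
  obtain ⟨C₂, hC₂, hdouble⟩ := hsb.exists_doubling
  have hpoint : ∀ z ∈ U, ∃ ξ : L2Fun ν, Ψ' ξ ∈ S ∧ c / 2 ≤ f (z - Ψ' ξ) ∧
      ∀ δ > 0, VisitsLinearly μ X (Metric.ball ξ δ) := by
    intro z hz
    have hfreq : ∃ᶠ ω in ae μ, c / 2 ≤ f (z - Ψ (X 0 ω)) := by
      -- otherwise the mean would be at most `c / 2`, also if the integral takes its junk value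
      intro hcon
      have h1 : fX μ Ψ X f z ≤ c / 2 := by
        unfold fX
        by_cases hi : Integrable (fun ω => f (z - Ψ (X 0 ω))) μ
        · have h2 : ∫ ω, f (z - Ψ (X 0 ω)) ∂μ ≤ ∫ _, c / 2 ∂μ := by
            refine integral_mono_ae hi (integrable_const _) ?_
            filter_upwards [hcon] with ω hω
            exact (not_le.1 hω).le
          simpa using h2
        · rw [integral_undef hi]; positivity
      have h3 := hcU z hz
      linarith
    obtain ⟨ω, hω, hωS, hωv⟩ := (hfreq.and_eventually ((hX.ae_apply_mem heq 0).and
      (h.ae_visitsLinearly_ball hB hX.integrable))).exists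
    refine ⟨X 0 ω, hωS, ?_, hωv⟩
    rwa [heq _ (hX.mem_X _ _)]
  choose! ξ hξS hξf hξv using hpoint
  obtain ⟨T, hTU, hTfin, hTcov⟩ :=
    Metric.finite_approx_of_totallyBounded hU (δ / 2) (by positivity)
  refine ⟨hTfin.toFinset, ξ, δ / 2, c / 8 / C₂, by positivity, fun z hz => ?_, ?_⟩
  · exact hξv z (hTU (by simpa using hz)) _ (by positivity)
  have hall : ∀ᶠ u in 𝓝[>] (0 : ℝ), ∀ z ∈ hTfin.toFinset, ∀ y' ∈ S,
      ‖y' - (z - Ψ' (ξ z))‖ ≤ δ → c / 2 / 4 * φ u ≤ smallBall μ (ε 0) y' u := by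
    rw [eventually_all_finset]
    intro z hz
    have hzU : z ∈ U := hTU (by simpa using hz)
    exact hlow _ (S.sub_mem (hUS hzU) (hξS z hzU)) (hξf z hzU)
  have hhalf : Tendsto (fun u : ℝ => u / 2) (𝓝[>] 0) (𝓝[>] 0) := by
    refine tendsto_nhdsWithin_iff.2 ⟨?_, ?_⟩
    · have : Tendsto (fun u : ℝ => u / 2) (𝓝 0) (𝓝 (0 / 2)) := tendsto_id.div_const 2
      rw [zero_div] at this
      exact this.mono_left nhdsWithin_le_nhds
    · filter_upwards [self_mem_nhdsWithin] with u hu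
      exact half_pos (Set.mem_Ioi.1 hu)
  filter_upwards [hall, hhalf.eventually hdouble] with u hu hd x hx
  obtain ⟨z, hz, hxz⟩ := Set.mem_iUnion₂.1 (hTcov hx)
  refine ⟨z, by simpa using hz, fun x' hx' hS' => ?_⟩
  have hmem : x - Ψ' x' ∈ S := S.sub_mem (hUS hx) hS'
  have h1 : ‖x - Ψ' x' - (z - Ψ' (ξ z))‖ ≤ δ := by
    have e1 : x - Ψ' x' - (z - Ψ' (ξ z)) = (x - z) - (Ψ' x' - Ψ' (ξ z)) := by abel
    rw [e1]
    refine (norm_sub_le _ _).trans ?_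
    have e2 : ‖x - z‖ < δ / 2 := by rw [← dist_eq_norm]; exact hxz
    have e3 : ‖Ψ' x' - Ψ' (ξ z)‖ ≤ L * ‖x' - ξ z‖ := by
      rw [← dist_eq_norm, ← dist_eq_norm]; exact h.lipschitz.dist_le_mul _ _
    have e4 : ‖x' - ξ z‖ < δ / 2 := by rw [← dist_eq_norm]; exact hx'
    have e5 : (L : ℝ) * ‖x' - ξ z‖ ≤ ‖x' - ξ z‖ :=
      mul_le_of_le_one_left (norm_nonneg _) (by exact_mod_cast h.lt_one.le)
    linarith
  have h2 := hu z (by simpa using hz) _ hmem h1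
  have h3 := hd _ hmem
  rw [mul_div_cancel₀ u two_ne_zero] at h3
  rw [div_mul_eq_mul_div, div_le_iff₀ hC₂]
  linarith

/-- The kernel estimator has uniform error at most `h n + C * lam n` on `U`, outside events of summable
probability. -/
theorem exists_tsum_measure_kernelEstimate_ne_top (hD : IsRegularDomain D ν)
    (hS : ∀ x ∈ S, ∃ r : ℝ, x ∈ lipBall D ν r) (hΨ : IsRegressionOperator D S Ψ)
    (hX : IsFAR1 μ S Ψ X ε)
    (hmom : ∃ C H : ℝ, 1 < H ∧ ∀ m : ℕ, 2 ≤ m → Integrable (fun ω => ‖ε 0 ω‖ ^ m) μ ∧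
      ∫ ω, ‖ε 0 ω‖ ^ m ∂μ ≤ C * (m.factorial : ℝ) * H ^ (m - 2))
    {K : ℝ → ℝ} (hK : IsKernel K) {α : ℝ} (hα : 0 < α) {x₀ : L2Fun ν} (hx₀ : x₀ ∈ S)
    {f : L2Fun ν → ℝ} {φ : ℝ → ℝ} (hsb : SmallBallCond D μ S (ε 0) α x₀ f φ)
    {h : ℕ → ℝ} (hpos : ∀ n, 0 < h n) (hlim : Tendsto h atTop (𝓝 0))
    {lam : ℕ → ℝ} (lam_pos : ∀ n, 0 < lam n) (lam_lim : Tendsto lam atTop (𝓝 0))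
    {U : Set (L2Fun ν)} (hUS : U ⊆ (S : Set (L2Fun ν))) (hU : TotallyBounded U)
    (hfX : ∃ c > 0, ∀ x ∈ U, c ≤ fX μ Ψ X f x)
    (hsum : ∃ c > 0, Summable fun n : ℕ =>
      Real.exp (-(lam n ^ 2 * (c * (n * φ (h n) / Real.log n)))) * Real.log n)
    (hcov : Tendsto (fun n : ℕ => Real.log (coverNum U (h n * lam n)) * Real.log n
      / (n * φ (h n) * lam n ^ 2)) atTop (𝓝 0)) :
    ∃ C > 0, ∑' n, μ {ω | ∃ x ∈ U, h n + C * lam n < ‖kernelEstimate K X n (h n) x ω - Ψ x‖} ≠ ⊤ := by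
  have := hD.secondCountableTopology
  obtain ⟨L, hL, hΨL⟩ := hΨ.contraction
  obtain ⟨Ψ', hlip, heq⟩ := hΨL.exists_lipschitzWith_eqOn_submodule
  have hch := hX.isContractiveChain hL hlip heq
  have hlaw := hch.isProbabilityMeasure_law
  have hε0 := hX.measurable_ε 0
  have hint : Integrable (fun y : L2Fun ν => y) (μ.map (ε 0)) :=
    (integrable_map_measure measurable_id.aestronglyMeasurable hε0.aemeasurable).2 hX.integrable
  have hcent : ∫ y, y ∂(μ.map (ε 0)) = 0 := by
    have e := integral_map (μ := μ) hε0.aemeasurable (f := fun y : L2Fun ν => y)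
      measurable_id.aestronglyMeasurable
    exact e.trans hX.centred
  obtain ⟨θ₀, V, hB⟩ : ∃ θ₀ V, HasBernsteinBound (μ.map (ε 0)) θ₀ V := by
    obtain ⟨C, H, hH, hm⟩ := hmom
    refine hasBernsteinBound_of_moments (C := C) hH hint.norm fun k hk => ?_
    have hmeas : Measurable fun y : L2Fun ν => ‖y‖ ^ k := measurable_norm.pow_const k
    rw [integral_map hε0.aemeasurable hmeas.aestronglyMeasurable]
    exact ⟨(integrable_map_measure hmeas.aestronglyMeasurable hε0.aemeasurable).2 (hm k hk).1,
      (hm k hk).2⟩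
  obtain ⟨T, ξ, δ, c₀, hc₀, hvis, hlow⟩ :=
    exists_reference_points hX hch heq hB hα hx₀ hsb hS hUS hU hfX
  obtain ⟨c₁, hc₁, hrare⟩ := exists_forall_finset_tsum_ne_top T
    (F := fun z c n => μ {ω | ∑ k ∈ Finset.range n,
      (Metric.ball (ξ z) δ).indicator (fun _ => (1 : ℝ)) (X k ω) < c * n})
    (fun z n c c' hcc => measure_mono fun ω hω => lt_of_lt_of_le (show _ < _ from hω)
      (mul_le_mul_of_nonneg_right hcc (Nat.cast_nonneg n)))
    hvis
  obtain ⟨C₁, hC₁, hdouble⟩ := hsb.exists_doubling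
  obtain ⟨C₂, hC₂, hup⟩ := hsb.exists_le_mul hα hx₀ hS (hX.mem_ε 0)
  obtain ⟨C₃, hann⟩ := hsb.annulus
  obtain ⟨M, hM⟩ := hK.contDiffOn.exists_lipschitzOnWith one_ne_zero (convex_Icc 0 1)
    isCompact_Icc
  have hh : Tendsto h atTop (𝓝[>] 0) :=
    tendsto_nhdsWithin_iff.2 ⟨hlim, Eventually.of_forall hpos⟩
  -- `C * φ (h n)` bounds the probability of a ball of radius `2 * h n`, and `lam n * (C * φ (h n))` that
  -- of the annulus in `oscWeight`.
  set C : ℝ := max (C₁ * C₂) (2 * |C₃| * C₂) with hC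
  have hC0 : 0 ≤ C := le_trans (by positivity) (le_max_left _ _)
  set A : ℝ := K 0 / θ₀ * (1 + 2 * V * θ₀ ^ 2 * (1 + 2 * C)) with hA
  set A' : ℝ := θ₀⁻¹ + V * (1 + 2 * C) with hA'
  have hK1 := hK.pos
  have hK0 := hK.zero_pos
  have hθ := hB.pos
  have hV := hB.nonneg
  have hM0 := M.coe_nonneg
  refine ⟨(A + (4 * M + 2 * K 0) * A') / (K 1 * (c₀ * c₁ / 4)), by positivity, ?_⟩
  have hrate := eventually_mul_exp_le (p := fun n => φ (h n)) (hh.eventually hsb.φ_pos) lam_pos hsum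
    hcov (c := min 1 (c₀ * c₁ / 4)) (lt_min one_pos (by positivity))
  have hsq : ∑' n : ℕ, 5 * ENNReal.ofReal (1 / (n : ℝ) ^ 2) ≠ ⊤ := by
    rw [ENNReal.tsum_mul_left]
    exact ENNReal.mul_ne_top (by norm_num)
      (Real.summable_one_div_nat_pow.2 one_lt_two).tsum_ofReal_ne_top
  refine tsum_ne_top_of_eventually_le (fun n => measure_ne_top _ _) ?_
    (tsum_add_ne_top hrare hsq)
  filter_upwards [hrate, hh.eventually hsb.φ_pos, hh.eventually hlow, hh.eventually hdouble,
    hh.eventually hup, hh.eventually hann, eventually_gt_atTop 0,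
    lam_lim.eventually_le_const (show (0 : ℝ) < 1 / 4 by norm_num)]
    with n grate gφ glow gdouble gup gann gn glam
  have hb := hpos n
  have hl := lam_pos n
  have hn0 : (0 : ℝ) < n := by exact_mod_cast gn
  set s : ℝ := n * φ (h n) with hs
  have hs0 : 0 < s := by positivity
  obtain ⟨N, hNU, hNcard, hNnet⟩ := exists_net_card_le_coverNum hU (mul_pos hb hl)
  choose! ζ hζT hζlow using glow
  have hpt : ∀ z ∈ N, μ {ω | c₁ * n ≤ ∑ k ∈ Finset.range n,
        (Metric.ball (ξ (ζ z)) δ).indicator (fun _ => (1 : ℝ)) (X k ω) ∧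
        ¬ GoodSample X ε K (h n) (lam n) s (c₀ * c₁ / 4) A A' n z ω}
      ≤ 5 * ENNReal.ofReal (Real.exp (-(min 1 (c₀ * c₁ / 4) * (lam n ^ 2 * s)))) := by
    intro z hz
    have hzS : z ∈ S := hUS (hNU hz)
    refine hch.measure_not_goodSample_le hB hint hcent hK hb hl (by linarith) gφ hC0 hc₀ hc₁ n z
      measurableSet_ball ?_ ?_ ?_
    · intro t
      filter_upwards [hX.ae_apply_mem heq t] with ω hω
      rw [smallBall_eq_map hε0]
      have h1 := gdouble _ (S.sub_mem hzS hω)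
      have h2 := gup (z - Ψ' (X t ω))
      calc _ ≤ C₁ * (C₂ * φ (h n)) := h1.trans (by gcongr)
        _ = C₁ * C₂ * φ (h n) := by ring
        _ ≤ C * φ (h n) := by gcongr; exact le_max_left _ _
    · intro t
      filter_upwards [hX.ae_apply_mem heq t] with ω hω
      have h0 : 0 < 2 * h n * lam n := by positivity
      rw [smallBall_annulus_eq_map hε0 _ _ (by linarith)]
      have h1 := gann (2 * h n * lam n) h0 (by nlinarith) _ (S.sub_mem hzS hω)
      have h2 := gup (z - Ψ' (X t ω))
      have e1 : 2 * h n * lam n / h n = 2 * lam n := by field_simp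
      rw [e1] at h1
      have h3 : (0 : ℝ) ≤ smallBall μ (ε 0) (z - Ψ' (X t ω)) (h n) := smallBall_nonneg _ _
      calc _ ≤ C₃ * (2 * lam n) * smallBall μ (ε 0) (z - Ψ' (X t ω)) (h n) := h1
        _ ≤ |C₃| * (2 * lam n) * (C₂ * φ (h n)) := by
            gcongr
            exact le_abs_self _
        _ = lam n * (2 * |C₃| * C₂ * φ (h n)) := by ring
        _ ≤ lam n * (C * φ (h n)) := by gcongr; exact le_max_right _ _
    · intro t
      filter_upwards [hX.ae_apply_mem heq t] with ω hω hωB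
      rw [smallBall_eq_map hε0]
      exact hζlow z (hNU hz) _ hωB hω
  have hunion : μ (⋃ z ∈ N, {ω | c₁ * n ≤ ∑ k ∈ Finset.range n,
        (Metric.ball (ξ (ζ z)) δ).indicator (fun _ => (1 : ℝ)) (X k ω) ∧
        ¬ GoodSample X ε K (h n) (lam n) s (c₀ * c₁ / 4) A A' n z ω})
      ≤ 5 * ENNReal.ofReal (1 / (n : ℝ) ^ 2) := by
    refine (measure_biUnion_finset_le _ _).trans ((Finset.sum_le_sum hpt).trans ?_)
    rw [Finset.sum_const, nsmul_eq_mul, mul_left_comm]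
    refine mul_le_mul_right ?_ _
    rw [← ENNReal.ofReal_natCast, ← ENNReal.ofReal_mul (Nat.cast_nonneg _)]
    refine ENNReal.ofReal_le_ofReal (le_trans ?_ grate)
    gcongr
  have hrare' : μ (⋃ z ∈ T, {ω | ∑ k ∈ Finset.range n,
      (Metric.ball (ξ z) δ).indicator (fun _ => (1 : ℝ)) (X k ω) < c₁ * n}) ≤ _ :=
    measure_biUnion_finset_le _ _
  refine (measure_mono_ae ?_).trans ((measure_union_le _ _).trans (add_le_add hrare' hunion))
  filter_upwards [hch.equation] with ω hω hbad
  obtain ⟨x, hxU, hx⟩ := hbad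
  by_contra hcon
  replace hcon : ¬ (ω ∈ (_ : Set Ω) ∪ _) := hcon
  simp only [Set.mem_union, Set.mem_iUnion, Set.mem_ofPred_eq, not_or, not_exists, not_lt,
    not_and, not_not] at hcon
  obtain ⟨hc1, hc2⟩ := hcon
  obtain ⟨z, hzN, hxz⟩ := hNnet x hxU
  obtain ⟨g1, g2, g3⟩ := hc2 z hzN (hc1 _ (hζT z (hNU hzN)))
  have hψ : ∀ k : ℕ, ‖Ψ' (X (k + 1) ω) - Ψ' x‖ ≤ ‖X (k + 1) ω - x‖ := fun k => by
    have e := hlip.dist_le_mul (X (k + 1) ω) x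
    rw [dist_eq_norm, dist_eq_norm] at e
    exact e.trans (mul_le_of_le_one_left (norm_nonneg _) (by exact_mod_cast hL.le))
  have hfinal := hK.norm_estimate_sub_le hM hb hl glam (x := x) (z := z) (by linarith)
    (ξ := fun k => X (k + 1) ω) (ψ := fun k => Ψ' (X (k + 1) ω)) (η := fun k => ε (k + 1 + 1) ω)
    (ψx := Ψ' x) hψ (by positivity) hs0 g1 g2 g3
  have hnext : ∀ k : ℕ, Ψ' (X (k + 1) ω) + ε (k + 1 + 1) ω = X (k + 1 + 1) ω := fun k => by
    have e := hω (k + 1 + 1)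
    rw [add_sub_cancel_right] at e
    exact e.symm
  simp only [hnext] at hfinal
  rw [← kernelEstimate_eq_sum_range, heq x (hUS hxU)] at hfinal
  exact absurd hx (not_lt.2 hfinal)

end Main

/-! ### Uniform rates -/

section Envelope

variable {d : ℕ} {D : Set (Euc d)} {ν : Measure (Euc d)} {Ω : Type*}

theorem lipBall_mono {r r' : ℝ} (h : r ≤ r') : lipBall D ν r ⊆ lipBall D ν r' := by
  rintro x ⟨g, hg, M, L, hL, hML, h1, h2⟩
  exact ⟨g, hg, M, L, hL, hML.trans h, h1, h2⟩

theorem norm_kernelEstimate_le {K : ℝ → ℝ} (hK : IsKernel K) (X : ℤ → Ω → L2Fun ν) (n : ℕ) (b : ℝ)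
    (x : L2Fun ν) (ω : Ω) :
    ‖kernelEstimate K X n b x ω‖ ≤ ∑ t ∈ Finset.Icc 1 n, ‖X ((t : ℤ) + 1) ω‖ := by
  unfold kernelEstimate
  have hw : ∀ t : ℕ, 0 ≤ kweight K X b t x ω := fun t => hK.nonneg _
  have hQ : 0 ≤ ∑ t ∈ Finset.Icc 1 n, kweight K X b t x ω := Finset.sum_nonneg fun t _ => hw t
  rw [norm_smul, norm_inv, Real.norm_of_nonneg hQ]
  refine inv_mul_le_of_le_mul₀ hQ (Finset.sum_nonneg fun _ _ => norm_nonneg _) ?_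
  refine (norm_sum_le _ _).trans ?_
  rw [Finset.mul_sum]
  refine Finset.sum_le_sum fun t ht => ?_
  rw [norm_smul, Real.norm_of_nonneg (hw t)]
  exact mul_le_mul_of_nonneg_right
    (Finset.single_le_sum (f := fun t : ℕ => kweight K X b t x ω) (fun t _ => hw t) ht)
    (norm_nonneg _)

theorem norm_psiHat_le {K : ℝ → ℝ} (hK : IsKernel K) (X : ℤ → Ω → L2Fun ν) (r : ℝ) (n : ℕ) (b : ℝ)
    (x : L2Fun ν) (ω : Ω) :
    ‖psiHat D K X r n b x ω‖ ≤ ∑ t ∈ Finset.Icc 1 n, ‖X (t : ℤ) ω‖ +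
      ∑ t ∈ Finset.Icc 1 n, ‖X ((t : ℤ) + 1) ω‖ := by
  have h1 : 0 ≤ ∑ t ∈ Finset.Icc 1 n, ‖X (t : ℤ) ω‖ := Finset.sum_nonneg fun _ _ => norm_nonneg _
  have h2 : 0 ≤ ∑ t ∈ Finset.Icc 1 n, ‖X ((t : ℤ) + 1) ω‖ :=
    Finset.sum_nonneg fun _ _ => norm_nonneg _
  unfold psiHat
  split_ifs
  · linarith [norm_kernelEstimate_le hK X n b x ω]
  · rw [norm_smul, norm_inv, Real.norm_natCast]
    have h3 := norm_sum_le (Finset.Icc 1 n) fun t : ℕ => X (t : ℤ) ω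
    have h4 : ((n : ℝ))⁻¹ ≤ 1 := Nat.cast_inv_le_one n
    have h5 : (n : ℝ)⁻¹ * ‖∑ t ∈ Finset.Icc 1 n, X (t : ℤ) ω‖ ≤
        ‖∑ t ∈ Finset.Icc 1 n, X (t : ℤ) ω‖ := mul_le_of_le_one_left (norm_nonneg _) h4
    linarith

/-- A bound of order `a n + C * lam n` outside sets of summable measure, together with some measurable
envelope on these sets, gives a bound `a n + B n` everywhere with `B` almost completely of order
`lam`. -/
theorem exists_isBigOAC_of_envelope [MeasurableSpace Ω] {μ : Measure Ω} {lam : ℕ → ℝ}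
    (lam_pos : ∀ n, 0 < lam n) {C : ℝ} (hC : 0 < C) {bad : ℕ → Set Ω}
    (hbad : ∑' n, μ (bad n) ≠ ⊤) {F : ℕ → Ω → ℝ} (hF : ∀ n, Measurable (F n))
    (hF0 : ∀ n ω, 0 ≤ F n ω) :
    ∃ B : ℕ → Ω → ℝ, (∀ n, Measurable (B n)) ∧ IsBigOAC μ B lam ∧
      (∀ n ω, ω ∉ bad n → C * lam n ≤ B n ω) ∧ ∀ n ω, ω ∈ bad n → F n ω ≤ B n ω := by
  refine ⟨fun n ω => C * lam n + (toMeasurable μ (bad n)).indicator (F n) ω, fun n => ?_,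
    ⟨C, hC, ?_⟩, fun n ω _ => ?_, fun n ω hω => ?_⟩
  · exact measurable_const.add ((hF n).indicator (measurableSet_toMeasurable _ _))
  · refine ne_top_of_le_ne_top hbad (ENNReal.tsum_le_tsum fun n => ?_)
    rw [← measure_toMeasurable (bad n)]
    refine measure_mono fun ω hω => ?_
    by_contra hcon
    have h0 : 0 ≤ C * lam n := (mul_pos hC (lam_pos n)).le
    simp only [Set.mem_ofPred_eq, Set.indicator_of_notMem hcon, add_zero, abs_of_nonneg h0,
      lt_irrefl] at hω
  · exact le_add_of_nonneg_right (Set.indicator_nonneg (fun ω _ => hF0 n ω) ω)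
  · change F n ω ≤ C * lam n + _
    rw [Set.indicator_of_mem (subset_toMeasurable μ _ hω)]
    exact le_add_of_nonneg_left (mul_pos hC (lam_pos n)).le

theorem exists_tsum_measure_ne_top_of_isBigOAC [MeasurableSpace Ω] {μ : Measure Ω}
    [IsProbabilityMeasure μ] {ι : Type*} {U : Set ι} {h lam : ℕ → ℝ} {B : ℕ → Ω → ℝ}
    (lam_pos : ∀ n, 0 < lam n) (hB : IsBigOAC μ B lam)
    (hbdd : IsBoundedUnder (· ≤ ·) atTop (fun n => h n / lam n)) {G : ℕ → Ω → ι → ℝ}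
    (hG : ∀ n ω, ∀ x ∈ U, G n ω x ≤ h n + B n ω) :
    ∃ C > 0, ∑' n, μ {ω | ∃ x ∈ U, C * lam n < G n ω x} ≠ ⊤ := by
  obtain ⟨C, hC, hs⟩ := hB
  obtain ⟨b, hb⟩ := hbdd
  refine ⟨C + |b|, by positivity, tsum_ne_top_of_eventually_le (fun n => measure_ne_top _ _) ?_ hs⟩
  filter_upwards [eventually_map.1 hb] with n hn
  refine measure_mono fun ω hω => ?_
  obtain ⟨x, hx, hlt⟩ := hω
  have h1 := hG n ω x hx
  have hl := lam_pos n
  rw [div_le_iff₀ hl] at hn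
  have h2 : b * lam n ≤ |b| * lam n := mul_le_mul_of_nonneg_right (le_abs_self b) hl.le
  refine lt_of_lt_of_le ?_ (le_abs_self (B n ω))
  linarith

end Envelope

theorem theoremA2 {d : ℕ} {D : Set (Euc d)} {ν : Measure (Euc d)} (hD : IsRegularDomain D ν)
    {Ω : Type*} [MeasurableSpace Ω] (μ : Measure Ω) [IsProbabilityMeasure μ]
    (S : Submodule ℝ (L2Fun ν)) (hS : ∀ x ∈ S, ∃ r : ℝ, x ∈ lipBall D ν r)
    (e : HilbertBasis ℕ ℝ (L2Fun ν))
    (Ψ : L2Fun ν → L2Fun ν) (hΨ : IsRegressionOperator D S Ψ)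
    (X ε : ℤ → Ω → L2Fun ν) (hX : IsFAR1 μ S Ψ X ε) (hmom : MomentCond D μ e X ε)
    (K : ℝ → ℝ) (hK : IsKernel K)
    (α : ℝ) (hα : 0 < α) (x₀ : L2Fun ν) (hx₀ : x₀ ∈ S)
    (f : L2Fun ν → ℝ) (φ : ℝ → ℝ) (hsb : SmallBallCond D μ S (ε 0) α x₀ f φ)
    (h : ℕ → ℝ) (hpos : ∀ n, 0 < h n) (hlim : Tendsto h atTop (𝓝 0))
    (herg : ErgodicCond D μ S Ψ X ε f φ h)
    (r : ℕ → ℝ) (hr : Tendsto r atTop atTop)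
    (lam : ℕ → ℝ) (lam_pos : ∀ n, 0 < lam n) (lam_lim : Tendsto lam atTop (𝓝 0))
    (U : Set (L2Fun ν)) (hUS : U ⊆ (S : Set (L2Fun ν))) (hU : TotallyBounded U)
    (hfX : ∃ c > 0, ∀ x ∈ U, c ≤ fX μ Ψ X f x)
    (hsum : ∃ c > 0, Summable fun n : ℕ =>
      Real.exp (-(lam n ^ 2 * (c * (n * φ (h n) / Real.log n)))) * Real.log n)
    (hcov : Tendsto (fun n : ℕ => Real.log (coverNum U (h n * lam n)) * Real.log n
      / (n * φ (h n) * lam n ^ 2)) atTop (𝓝 0)) :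
    (∃ (a : ℕ → ℝ) (B : ℕ → Ω → ℝ), a =O[atTop] h ∧ (∀ n, Measurable (B n)) ∧
      IsBigOAC μ B lam ∧
      ((∃ ρ : ℝ, U ⊆ lipBall D ν ρ) → ∀ n ω, ∀ x ∈ U,
        ‖psiHat D K X (r n) n (h n) x ω - Ψ x‖ ≤ a n + B n ω) ∧
      (∀ n ω, ∀ x ∈ U, ‖kernelEstimate K X n (h n) x ω - Ψ x‖ ≤ a n + B n ω)) ∧
    (IsBoundedUnder (· ≤ ·) atTop (fun n => h n / lam n) →
      ((∃ ρ : ℝ, U ⊆ lipBall D ν ρ) → ∃ C > 0,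
        ∑' n, μ {ω | ∃ x ∈ U, C * lam n < ‖psiHat D K X (r n) n (h n) x ω - Ψ x‖} ≠ ⊤) ∧
      ∃ C > 0,
        ∑' n, μ {ω | ∃ x ∈ U, C * lam n < ‖kernelEstimate K X n (h n) x ω - Ψ x‖} ≠ ⊤) := by
  classical
  obtain ⟨C, hC, hbad⟩ := exists_tsum_measure_kernelEstimate_ne_top hD hS hΨ hX hmom.bernstein hK hα
    hx₀ hsb hpos hlim lam_pos lam_lim hUS hU hfX hsum hcov
  obtain ⟨Q, hQ0, hQ⟩ : ∃ Q, 0 ≤ Q ∧ ∀ x ∈ U, ‖Ψ x‖ ≤ Q := by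
    obtain ⟨L, -, hL⟩ := hΨ.contraction
    obtain ⟨R, hR⟩ := hU.isBounded.exists_norm_le
    refine ⟨‖Ψ 0‖ + L * |R|, by positivity, fun x hx => ?_⟩
    have h1 := hL.dist_le_mul x (hUS hx) 0 S.zero_mem
    rw [dist_eq_norm, dist_eq_norm, sub_zero] at h1
    have h2 : (L : ℝ) * ‖x‖ ≤ L * |R| := by
      gcongr
      exact (hR x hx).trans (le_abs_self R)
    have h3 := norm_le_norm_add_norm_sub (Ψ 0) (Ψ x)
    rw [norm_sub_rev] at h3
    linarith
  set F : ℕ → Ω → ℝ := fun n ω => (∑ t ∈ Finset.Icc 1 n, ‖X (t : ℤ) ω‖ +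
    ∑ t ∈ Finset.Icc 1 n, ‖X ((t : ℤ) + 1) ω‖) + Q with hF
  have hFm : ∀ n, Measurable (F n) := fun n => by
    refine ((Finset.measurable_fun_sum _ fun t _ => ?_).add
      (Finset.measurable_fun_sum _ fun t _ => ?_)).add measurable_const
    · exact (hX.measurable_X _).norm
    · exact (hX.measurable_X _).norm
  have hsum0 : ∀ (n : ℕ) (ω : Ω), 0 ≤ ∑ t ∈ Finset.Icc 1 n, ‖X (t : ℤ) ω‖ := fun n ω =>
    Finset.sum_nonneg fun _ _ => norm_nonneg _
  have hF0 : ∀ n ω, 0 ≤ F n ω := fun n ω =>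
    add_nonneg (add_nonneg (hsum0 n ω) (Finset.sum_nonneg fun _ _ => norm_nonneg _)) hQ0
  have hFk : ∀ n ω, ∀ x ∈ U, ‖kernelEstimate K X n (h n) x ω - Ψ x‖ ≤ F n ω := fun n ω x hx => by
    have h1 := norm_sub_le (kernelEstimate K X n (h n) x ω) (Ψ x)
    have h2 := norm_kernelEstimate_le hK X n (h n) x ω
    have h3 := hQ x hx
    have h4 := hsum0 n ω
    simp only [hF]
    linarith
  have hFp : ∀ n ω, ∀ x ∈ U, ‖psiHat D K X (r n) n (h n) x ω - Ψ x‖ ≤ F n ω := fun n ω x hx =>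
    (norm_sub_le _ _).trans (add_le_add (norm_psiHat_le hK X (r n) n (h n) x ω) (hQ x hx))
  -- The two estimators differ on `U` for finitely many `n` only, which costs nothing.
  set bad : ℕ → Set Ω := fun n => {ω | (∃ x ∈ U,
    h n + C * lam n < ‖kernelEstimate K X n (h n) x ω - Ψ x‖) ∨ ((∃ ρ : ℝ, U ⊆ lipBall D ν ρ) ∧
      ∃ x ∈ U, h n + C * lam n < ‖psiHat D K X (r n) n (h n) x ω - Ψ x‖)} with hbaddef
  have hbad' : ∑' n, μ (bad n) ≠ ⊤ := by
    by_cases hρ : ∃ ρ : ℝ, U ⊆ lipBall D ν ρ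
    · obtain ⟨ρ, hUρ⟩ := hρ
      refine tsum_ne_top_of_eventually_le (fun n => measure_ne_top _ _) ?_ hbad
      filter_upwards [hr.eventually_ge_atTop ρ] with n hn
      refine measure_mono fun ω hω => ?_
      rcases hω with hω | ⟨-, x, hx, hlt⟩
      · exact hω
      · refine ⟨x, hx, ?_⟩
        unfold psiHat at hlt
        rwa [if_pos (lipBall_mono hn (hUρ hx))] at hlt
    · refine ne_top_of_le_ne_top hbad (ENNReal.tsum_le_tsum fun n => measure_mono fun ω hω => ?_)
      rcases hω with hω | ⟨hcon, -⟩
      · exact hω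
      · exact absurd hcon hρ
  obtain ⟨B, hBm, hBO, hBgood, hBbad⟩ := exists_isBigOAC_of_envelope lam_pos hC hbad' hFm hF0
  have hk : ∀ n ω, ∀ x ∈ U, ‖kernelEstimate K X n (h n) x ω - Ψ x‖ ≤ h n + B n ω := by
    intro n ω x hx
    by_cases hω : ω ∈ bad n
    · exact (hFk n ω x hx).trans ((hBbad n ω hω).trans (le_add_of_nonneg_left (hpos n).le))
    · have h1 := hBgood n ω hω
      have h2 := not_lt.1 fun hlt => hω (Or.inl ⟨x, hx, hlt⟩)
      linarith
  have hp : (∃ ρ : ℝ, U ⊆ lipBall D ν ρ) → ∀ n ω, ∀ x ∈ U,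
      ‖psiHat D K X (r n) n (h n) x ω - Ψ x‖ ≤ h n + B n ω := by
    intro hρ n ω x hx
    by_cases hω : ω ∈ bad n
    · exact (hFp n ω x hx).trans ((hBbad n ω hω).trans (le_add_of_nonneg_left (hpos n).le))
    · have h1 := hBgood n ω hω
      have h2 := not_lt.1 fun hlt => hω (Or.inr ⟨hρ, x, hx, hlt⟩)
      linarith
  exact ⟨⟨h, B, isBigO_refl h atTop, hBm, hBO, hp, hk⟩, fun hbdd =>
    ⟨fun hρ => exists_tsum_measure_ne_top_of_isBigOAC lam_pos hBO hbdd (hp hρ),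
      exists_tsum_measure_ne_top_of_isBigOAC lam_pos hBO hbdd hk⟩⟩
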